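/- Notation. For $X\subseteq\omega$, a set is $\Sigma^X_0$ if it is computable in $X$, and $\Sigma^X_{k+1}$ if it is the projection $\{x:\exists y\,\langle x,y\rangle\in R\}$ of a $\Pi^X_k$ relation $R$; $\Pi^X_k$ sets are the complements of $\Sigma^X_k$ sets, $\Delta^X_k=\Sigma^X_k\cap\Pi^X_k$, and $\Sigma^0_k,\Delta^0_k$ are these classes for $X=\emptyset$. A set is properly $\Delta^X_{k+1}$ if it is in $\Delta^X_{k+1}\setminus(\Sigma^X_k\cup\Pi^X_k)$. Let $[X]^n$ be the set of $n$-element subsets of $X$, identified with increasing sequences. A function $f:[\omega]^n\to\omega$ is stable if $\lim_x f(\sigma\langle x\rangle)$ exists for every $\sigma\in[\omega]^{n-1}$, and a set $X\subseteq\omega$ is $f$-thin if $f([X]^n)\neq\omega$. $\mathsf{TS}^n$ (respectively $\mathsf{STS}^n$) is the statement that every (respectively every stable) $f:[\omega]^n\to\omega$ has an infinite $f$-thin set; coding $f$ by a subset of $\omega$, each has the form $(\forall X)(\exists Y)\varphi(X,Y)$ with $X,Y\subseteq\omega$. Such a statement admits preservation of $\Delta^0_{i+1}$-definitions if for all $Z\subseteq\omega$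 and all $X\le_T Z$ there is $Y$ such that $\varphi(X,Y)$ holds and every properly $\Delta^Z_{i+1}$ set is properly $\Delta^{Z\oplus Y}_{i+1}$. Theorem. Let $n>1$. (1) There is a computable stable function $f:[\omega]^n\to\omega$ such that for every $i$ with $0<i<n$ and every infinite $f$-thin set $X$ there is a set $B\in(\Delta^0_{i+1}\setminus\Sigma^0_i)\cap\Sigma^X_i$. (2) For every $i$ with $0<i<n$, neither $\mathsf{STS}^n$ nor $\mathsf{TS}^n$ admits preservation of $\Delta^0_{i+1}$-definitions. -/

import Mathlib

open Filter

namespace Definability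

/-! ### Relative computability and the relativized arithmetic hierarchy -/

/-- The characteristic function of `X ⊆ ω`, as a (total) partial function. -/
noncomputable def char (X : Set ℕ) : ℕ →. ℕ := ((X.indicator 1 : ℕ → ℕ) : ℕ →. ℕ)

/-- `A ≤_T X` for sets of natural numbers. -/
def Reducible (A X : Set ℕ) : Prop := TuringReducible (char A) (char X)

/-- `X ⊕ Y`: the join of two sets of natural numbers. -/
def join (X Y : Set ℕ) : Set ℕ := (fun x => 2 * x) '' X ∪ (fun y => 2 * y + 1) '' Y

/-- `IsSigma X n A`: the set `A` is `Σ^X_n`. A set is `Σ^X_0` if it is computable in `X`, and it is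
`Σ^X_{n+1}` if it is of the form `{x : ∃ y, ⟨x, y⟩ ∉ R}` with `R` a `Σ^X_n` relation, i.e. if it is
the projection of a `Π^X_n` relation. -/
def IsSigma (X : Set ℕ) : ℕ → Set ℕ → Prop
  | 0, A => Reducible A X
  | n + 1, A => ∃ R : Set ℕ, IsSigma X n R ∧ A = {x | ∃ y, Nat.pair x y ∉ R}

/-- `A` is `Π^X_n`. -/
def IsPi (X : Set ℕ) (n : ℕ) (A : Set ℕ) : Prop := IsSigma X n Aᶜ

/-- `A` is `Δ^X_n`. -/
def IsDelta (X : Set ℕ) (n : ℕ) (A : Set ℕ) : Prop := IsSigma X n A ∧ IsPi X n A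

/-- `A` is properly `Δ^X_{n+1}`: it is `Δ^X_{n+1}`, but neither `Σ^X_n` nor `Π^X_n`. -/
def IsProperDeltaSucc (n : ℕ) (X A : Set ℕ) : Prop :=
  IsDelta X (n + 1) A ∧ ¬ IsSigma X n A ∧ ¬ IsPi X n A

/-! ### Preservation of definitions

Below `Ξ X A` stands for "`A` is properly `Ξ` relative to `X`". -/

/-- `Y` preserves (properly) `Ξ`-definitions relative to `X`. -/
def Preserves (Ξ : Set ℕ → Set ℕ → Prop) (X Y : Set ℕ) : Prop :=
  ∀ A, Ξ X A → Ξ (join X Y) A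

/-- The sentence `(∀ X) (∃ Y) φ(X, Y)` admits preservation of (properly) `Ξ`-definitions. -/
def AdmitsPreservation (Ξ φ : Set ℕ → Set ℕ → Prop) : Prop :=
  ∀ Z X : Set ℕ, Reducible X Z → ∃ Y : Set ℕ, Preserves Ξ Z Y ∧ φ X Y

/-! ### Colorings of `[ω]^n` and the Thin Set Theorem -/

/-- Functions `f : [ω]^n → ω`. -/
abbrev Coloring (n : ℕ) : Type := Set.powersetCard ℕ n → ℕ

/-- The strictly increasing sequence identified with an element of `[ω]^n`. -/
def seq {n : ℕ} (s : Set.powersetCard ℕ n) : List ℕ := (s : Finset ℕ).sort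

namespace Coloring

variable {n : ℕ}

/-- `f` is computable: on increasing sequences it agrees with a computable function of finite
sequences. -/
def IsComputable (f : Coloring n) : Prop :=
  ∃ F : List ℕ → ℕ, Computable F ∧ ∀ s, F (seq s) = f s

/-- `f` is stable: `lim_x f(σ⟨x⟩)` exists for every `σ ∈ [ω]^{n-1}`. -/
def IsStable (f : Coloring n) : Prop :=
  ∀ σ : Finset ℕ, σ.card + 1 = n →
    ∃ l : ℕ, ∀ᶠ x in atTop, ∀ τ : Set.powersetCard ℕ n, (τ : Finset ℕ) = insert x σ → f τ = l

/-- `G` is `f`-thin: `f([G]^n) ≠ ω`. -/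
def IsThin (f : Coloring n) (G : Set ℕ) : Prop :=
  f '' {s | ((s : Finset ℕ) : Set ℕ) ⊆ G} ≠ Set.univ

/-- The set of natural numbers which codes (the graph of) `f`. -/
def graph (f : Coloring n) : Set ℕ :=
  {m | ∃ s, m = Nat.pair (Encodable.encode (seq s)) (f s)}

end Coloring

/-- The matrix of `TS^n = (∀ X) (∃ Y) TS n X Y`: if `X` codes a coloring `f` of `[ω]^n`, then `Y` is
an infinite `f`-thin set. -/
def TS (n : ℕ) (X Y : Set ℕ) : Prop :=
  ∀ f : Coloring n, X = f.graph → Y.Infinite ∧ f.IsThin Y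

/-- The matrix of `STS^n = (∀ X) (∃ Y) STS n X Y`: if `X` codes a stable coloring `f` of `[ω]^n`,
then `Y` is an infinite `f`-thin set. -/
def STS (n : ℕ) (X Y : Set ℕ) : Prop :=
  ∀ f : Coloring n, X = f.graph → f.IsStable → Y.Infinite ∧ f.IsThin Y

end Definability

/-! The coloring is built by induction on `n`, relative to an arbitrary oracle `Z`. It is read on
decreasing lists `x :: σ`, with the color computed from `σ` and the first `x` bits of `Z`.

For `n = 2`, a finite injury construction yields, for every color `c`, a set `kept Z c` which is
`Δ_2` but not `Σ_1` relative to `Z`. To defeat the c.e. set with index `e`, a witness `m` is held in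
`kept Z c` until `m` is enumerated; then `m` is removed, and numbers `a ≥ m` receive the color `c`
unless a later witness `w ≤ a` takes over. If the color of `a` is not `c` at a stage `s ≥ a`, such a
`w` has intervened, and what lies below it was already present at stage `w ≤ a`. So the removal of
`m` is visible at stage `a` (`removed_of_color_ne`). An infinite set whose members all have limit
color different from `c` can therefore enumerate `kept Z c` (`exists_of_color`).

For `n + 1`, take a coloring `Φ` of `n`-sequences that works relative to the jump `Z'`. Given `b ::
a :: ρ`, ask whether `Z'` below `a` is already correctly approximated at stage `b`. If so, the limit
color is that given by `Φ` relative to `Z'`; if not, it is the finite injury color of `b`. Let `X`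
omit a color. For `i = 1`, either unsettled gaps supply an infinite set to which the case of pairs
applies, or almost all gaps are settled, and then `X ⊕ Z` computes `Z'`, which lowers the complexity
of the complement of a properly `Σ_1` set. For `i = j + 1`, `X ⊕ Z'` computes an infinite subset of
`X` with settled gaps; it omits the same color of `Φ`, and the induction hypothesis at level `j`
over `Z'` lifts by one jump (`Simplifying.extend`).

For preservation, the set so obtained is joined with a `Σ_i` set that is not `Π_i`, which makes it
properly `Δ_{i+1}`; over the thin set it becomes `Σ_i`. -/

namespace Definability

open Encodable

/-! ### Closure properties of oracle computability -/

section ComputableIn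

variable {α β γ : Type*} [Primcodable α] [Primcodable β] [Primcodable γ] {O : Set (ℕ →. ℕ)}

theorem computableIn_iff_nat {f : α → β} :
    ComputableIn O f ↔
      Nat.RecursiveIn O fun n => (decode (α := α) n : Part α).map fun a => encode (f a) := by
  unfold ComputableIn RecursiveIn
  simp [Part.map_some, Part.bind_some_eq_map]

theorem computableIn_nat {f : ℕ → ℕ} :
    ComputableIn O f ↔ Nat.RecursiveIn O (fun n => Part.some (f n)) :=
  RecursiveIn.iff_nat (f := (f : ℕ →. ℕ))

theorem computableIn_comp {f : β → γ} {g : α → β} (hf : ComputableIn O f)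
    (hg : ComputableIn O g) : ComputableIn O fun a => f (g a) := by
  rw [computableIn_iff_nat] at *
  refine (hf.comp hg).of_eq fun n => ?_
  cases h : decode (α := α) n <;> simp

theorem computableIn_pair {f : α → β} {g : α → γ} (hf : ComputableIn O f)
    (hg : ComputableIn O g) : ComputableIn O fun a => (f a, g a) := by
  rw [computableIn_iff_nat] at *
  refine (hf.pair hg).of_eq fun n => ?_
  cases h : decode (α := α) n <;> simp [Seq.seq]

theorem computableIn_natRec {v : ℕ → β} (hv : ComputableIn O v) (a₀ : γ) {G : ℕ × β × γ → γ}
    (hG : Computable G) {g : ℕ → γ} (h₀ : g 0 = a₀) (hs : ∀ n, g (n + 1) = G (n, v n, g n)) :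
    ComputableIn O g := by
  have h1 : Nat.RecursiveIn O fun _ : ℕ => Part.some (encode a₀) :=
    computableIn_nat.1 (ComputableIn.const (encode a₀))
  have h2 : ComputableIn O (fun p : ℕ =>
      (decode (α := γ) p.unpair.2.unpair.2).map fun c =>
        G (p.unpair.2.unpair.1, v p.unpair.2.unpair.1, c)) := by
    have hH : Computable fun q : ℕ × β =>
        (decode (α := γ) q.1.unpair.2.unpair.2).map fun c => G (q.1.unpair.2.unpair.1, q.2, c) := by
      have hu : Computable fun q : ℕ × β => q.1.unpair.2.unpair :=
        (Primrec.unpair.comp (Primrec.snd.comp (Primrec.unpair.comp Primrec.fst))).to_comp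
      have h5 : Computable fun q : (ℕ × β) × γ => (q.1.1.unpair.2.unpair.1, q.1.2, q.2) :=
        Computable.pair (Computable.fst.comp (hu.comp Computable.fst))
          (Computable.pair (Computable.snd.comp Computable.fst) Computable.snd)
      exact Computable.option_map (Computable.decode.comp (Computable.snd.comp hu)) (hG.comp h5).to₂
    have hw : ComputableIn O fun p : ℕ => v p.unpair.2.unpair.1 :=
      computableIn_comp hv (Primrec.fst.comp (Primrec.unpair.comp
        (Primrec.snd.comp Primrec.unpair))).to_comp.computableIn
    exact computableIn_comp (g := fun p : ℕ => (p, v p.unpair.2.unpair.1)) hH.computableIn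
      (computableIn_pair ComputableIn.id hw)
  -- `encode (some c) = encode c + 1`, so subtracting 1 strips the `Option`.
  have h3 : Nat.RecursiveIn O fun p : ℕ => Part.some (encode
      ((decode (α := γ) p.unpair.2.unpair.2).map fun c =>
        G (p.unpair.2.unpair.1, v p.unpair.2.unpair.1, c)) - 1) :=
    computableIn_nat.1 (computableIn_comp
      (f := fun o : Option γ => encode o - 1)
      (Primrec.to_comp (Primrec.pred.comp Primrec.encode)).computableIn h2)
  have h4 := (Nat.RecursiveIn.prec h1 h3).comp
    (Nat.RecursiveIn.pair (computableIn_nat.1 (ComputableIn.const (O := O) (α := ℕ) (0 : ℕ)))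
      (computableIn_nat.1 (ComputableIn.id (O := O) (α := ℕ))))
  rw [computableIn_iff_nat]
  refine h4.of_eq fun n => ?_
  have : ∀ n : ℕ, (Nat.rec (Part.some (encode a₀)) (fun y IH => IH.bind fun i => Part.some (encode
      ((decode (α := γ) i).map fun c => G (y, v y, c)) - 1)) n : Part ℕ) =
      Part.some (encode (g n)) := by
    intro n
    induction n with
    | zero => simp [h₀]
    | succ n ih => simp [ih, hs]
  simpa [Seq.seq] using this n

theorem computableIn_find {p : α → ℕ → Bool} (hp : ComputableIn O fun q : α × ℕ => p q.1 q.2)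
    (h : ∀ a, ∃ k, p a k = true) : ComputableIn O fun a => Nat.find (h a) := by
  -- `rfind` searches for the value 0, which encodes `false`; hence the negation.
  have h1 : Nat.RecursiveIn O fun n => (decode (α := α × ℕ) n : Part (α × ℕ)).map
      fun q => encode (! p q.1 q.2) := by
    have := computableIn_comp (Primrec.to_comp Primrec.not).computableIn hp
    exact computableIn_iff_nat.1 this
  rw [computableIn_iff_nat]
  refine (Nat.RecursiveIn.rfind h1).of_eq fun n => ?_
  cases hn : decode (α := α) n with
  | none =>
    simp only [Part.coe_none, Part.map_none]
    refine Part.eq_none_iff.2 fun a ha => ?_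
    have := Nat.rfind_spec ha
    simp [hn] at this
  | some a =>
    simp only [Part.coe_some, Part.map_some]
    refine Part.eq_some_iff.2 ?_
    rw [encode_nat]
    refine Nat.mem_rfind.2 ⟨?_, fun {m} hm => ?_⟩
    · simp [hn, Nat.find_spec (h a)]
    · have := Nat.find_min (h a) hm
      simp [hn, this]

end ComputableIn

/-! ### Initial segments of oracles and the use principle -/

/-- The characteristic function of `A`, with Boolean values. -/
noncomputable def chi (A : Set ℕ) (n : ℕ) : Bool :=
  open Classical in decide (n ∈ A)

@[simp] theorem chi_eq_true {A : Set ℕ} {n : ℕ} : chi A n = true ↔ n ∈ A := by simp [chi]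

@[simp] theorem chi_eq_false {A : Set ℕ} {n : ℕ} : chi A n = false ↔ n ∉ A := by simp [chi]

theorem char_eq (A : Set ℕ) : char A = fun n => Part.some (encode (chi A n)) := by
  funext n
  by_cases h : n ∈ A
  · have : chi A n = true := by simpa
    simp [char, h, this]
  · have : chi A n = false := by simpa
    simp [char, h, this]

theorem reducible_iff {A X : Set ℕ} : Reducible A X ↔ ComputableIn {char X} (chi A) := by
  unfold Reducible TuringReducible
  rw [RecursiveIn.iff_nat, char_eq A, computableIn_iff_nat]
  simp

/-- The initial segment of (the characteristic function of) `Z` of length `k`, listed with the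
last bit first. -/
noncomputable def restr (Z : Set ℕ) : ℕ → List Bool
  | 0 => []
  | k + 1 => chi Z k :: restr Z k

@[simp] theorem restr_length (Z : Set ℕ) (k : ℕ) : (restr Z k).length = k := by
  induction k with
  | zero => rfl
  | succ k ih => simp [restr, ih]

theorem restr_drop (Z : Set ℕ) {j k : ℕ} (h : j ≤ k) : (restr Z k).drop (k - j) = restr Z j := by
  induction k, h using Nat.le_induction with
  | base => simp
  | succ k hk ih => rw [Nat.succ_sub hk]; simpa [restr] using ih

theorem restr_suffix (Z : Set ℕ) {j k : ℕ} (h : j ≤ k) : restr Z j <:+ restr Z k := by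
  rw [← restr_drop Z h]; exact List.drop_suffix _ _

theorem eq_restr_of_suffix {Z : Set ℕ} {k : ℕ} {τ : List Bool} (h : τ <:+ restr Z k) :
    τ = restr Z τ.length := by
  have hl : τ.length ≤ k := by simpa using h.length_le
  rcases List.suffix_or_suffix_of_suffix h (restr_suffix Z hl) with h' | h'
  · exact h'.eq_of_length (by simp)
  · exact (h'.eq_of_length (by simp)).symm

theorem restr_congr {A B : Set ℕ} {k : ℕ} (h : ∀ p < k, p ∈ A ↔ p ∈ B) :
    restr A k = restr B k := by
  induction k with
  | zero => rfl
  | succ k ih =>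
    have hk := h k (Nat.lt_succ_self k)
    have : chi A k = chi B k := by rw [Bool.eq_iff_iff]; simpa using hk
    simp [restr, this, ih fun p hp => h p (hp.trans (Nat.lt_succ_self k))]

theorem restr_inj {A B : Set ℕ} {k : ℕ} (h : restr A k = restr B k) :
    ∀ p < k, p ∈ A ↔ p ∈ B := by
  induction k with
  | zero => intro p hp; omega
  | succ k ih =>
    simp only [restr, List.cons.injEq] at h
    intro p hp
    rcases Nat.lt_succ_iff_lt_or_eq.1 hp with hp | rfl
    · exact ih h.2 p hp
    · simpa using Bool.eq_iff_iff.1 h.1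

theorem computableIn_restr {A X : Set ℕ} (h : Reducible A X) :
    ComputableIn {char X} (restr A) :=
  computableIn_natRec (reducible_iff.1 h) [] (G := fun q => q.2.1 :: q.2.2)
    (Primrec.list_cons.comp (Primrec.fst.comp Primrec.snd)
      (Primrec.snd.comp Primrec.snd)).to_comp rfl fun _ => rfl

/-- The bit with index `n` of a reversed initial segment. -/
def lookup (σ : List Bool) (n : ℕ) : Option Bool := σ.reverse[n]?

theorem lookup_restr (Z : Set ℕ) {n k : ℕ} (h : n < k) : lookup (restr Z k) n = some (chi Z n) := by
  induction k with
  | zero => omega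
  | succ k ih =>
    simp only [lookup, restr, List.reverse_cons] at *
    rcases Nat.lt_succ_iff_lt_or_eq.1 h with h | rfl
    · rw [List.getElem?_append_left (by simpa using h)]; exact ih h
    · rw [List.getElem?_append_right (by simp)]; simp

theorem lookup_eq_some {Z : Set ℕ} {n k : ℕ} {b : Bool} (h : lookup (restr Z k) n = some b) :
    b = chi Z n := by
  have hn : n < k := by
    by_contra hn
    simp [lookup, List.getElem?_eq_none (show (restr Z k).reverse.length ≤ n by simpa using hn)] at h
  rw [lookup_restr Z hn] at h
  exact (Option.some.inj h).symm

/-- A function recursive in `Z` is the pointwise limit of a partial recursive functional applied to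
the initial segments of `Z`. -/
theorem exists_functional {Z : Set ℕ} {f : ℕ →. ℕ} (hf : Nat.RecursiveIn {char Z} f) :
    ∃ G : List Bool × ℕ →. ℕ, Partrec G ∧ (∀ k n, ∀ m ∈ G (restr Z k, n), m ∈ f n) ∧
      ∀ n, ∀ m ∈ f n, ∀ᶠ k in atTop, m ∈ G (restr Z k, n) := by
  induction hf with
  | zero =>
    refine ⟨fun _ => Part.some 0, (Computable.const 0).partrec, ?_, ?_⟩
    · intro k n m hm; exact hm
    · intro n m hm; exact Eventually.of_forall fun _ => hm
  | succ =>
    refine ⟨fun p => Part.some (p.2 + 1), (Computable.succ.comp Computable.snd).partrec, ?_, ?_⟩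
    · intro k n m hm; exact hm
    · intro n m hm; exact Eventually.of_forall fun _ => hm
  | left =>
    refine ⟨fun p => Part.some p.2.unpair.1,
      (Computable.fst.comp (Computable.unpair.comp Computable.snd)).partrec, ?_, ?_⟩
    · intro k n m hm; exact hm
    · intro n m hm; exact Eventually.of_forall fun _ => hm
  | right =>
    refine ⟨fun p => Part.some p.2.unpair.2,
      (Computable.snd.comp (Computable.unpair.comp Computable.snd)).partrec, ?_, ?_⟩
    · intro k n m hm; exact hm
    · intro n m hm; exact Eventually.of_forall fun _ => hm
  -- A query is answered from the bits at hand and diverges beyond them.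
  | oracle g hg =>
    obtain rfl : g = char Z := hg
    refine ⟨fun p => ((lookup p.1 p.2).map encode : Option ℕ), Computable.ofOption
      (Computable.option_map (Computable.list_getElem?.comp
        (Computable.list_reverse.comp Computable.fst) Computable.snd)
        (Computable.encode.comp Computable.snd).to₂), ?_, ?_⟩
    · intro k n m hm
      rw [char_eq]
      simp only [Part.mem_coe, Option.mem_def, Option.map_eq_some_iff] at hm
      obtain ⟨b, hb, rfl⟩ := hm
      rw [lookup_eq_some hb]
      exact Part.mem_some _
    · intro n m hm
      rw [char_eq] at hm
      obtain rfl := Part.mem_some_iff.1 hm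
      filter_upwards [eventually_gt_atTop n] with k hk
      simp [lookup_restr Z hk]
  | pair _ _ ih₁ ih₂ =>
    obtain ⟨G₁, h₁, s₁, e₁⟩ := ih₁
    obtain ⟨G₂, h₂, s₂, e₂⟩ := ih₂
    refine ⟨fun p => (G₁ p).bind fun a => (G₂ p).map fun b => Nat.pair a b,
      h₁.bind (Partrec.map (h₂.comp Computable.fst)
        (Primrec₂.natPair.to_comp.comp (Computable.snd.comp Computable.fst)
          Computable.snd).to₂).to₂, ?_, ?_⟩
    · intro k n m hm
      simp only [Part.mem_bind_iff, Part.mem_map_iff] at hm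
      obtain ⟨a, ha, b, hb, rfl⟩ := hm
      simp only [Seq.seq, Part.map_eq_map, Part.mem_bind_iff, Part.mem_map_iff]
      exact ⟨_, ⟨a, s₁ _ _ _ ha, rfl⟩, b, s₂ _ _ _ hb, rfl⟩
    · intro n m hm
      simp only [Seq.seq, Part.map_eq_map, Part.mem_bind_iff,
        Part.mem_map_iff] at hm
      obtain ⟨_, ⟨a, ha, rfl⟩, b, hb, rfl⟩ := hm
      filter_upwards [e₁ _ _ ha, e₂ _ _ hb] with k hk₁ hk₂
      simp only [Part.mem_bind_iff, Part.mem_map_iff]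
      exact ⟨a, hk₁, b, hk₂, rfl⟩
  | comp _ _ ih₁ ih₂ =>
    obtain ⟨G₁, h₁, s₁, e₁⟩ := ih₁
    obtain ⟨G₂, h₂, s₂, e₂⟩ := ih₂
    refine ⟨fun p => (G₂ p).bind fun a => G₁ (p.1, a),
      h₂.bind (h₁.comp (Computable.pair (Computable.fst.comp Computable.fst)
        Computable.snd)).to₂, ?_, ?_⟩
    · intro k n m hm
      obtain ⟨a, ha, hm⟩ := Part.mem_bind_iff.1 hm
      exact Part.mem_bind_iff.2 ⟨a, s₂ _ _ _ ha, s₁ _ _ _ hm⟩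
    · intro n m hm
      obtain ⟨a, ha, hm⟩ := Part.mem_bind_iff.1 hm
      filter_upwards [e₁ _ _ hm, e₂ _ _ ha] with k hk₁ hk₂
      exact Part.mem_bind_iff.2 ⟨a, hk₂, hk₁⟩
  | @prec f h _ _ ih₁ ih₂ =>
    obtain ⟨G₁, h₁, s₁, e₁⟩ := ih₁
    obtain ⟨G₂, h₂, s₂, e₂⟩ := ih₂
    refine ⟨fun p => Nat.rec (G₁ (p.1, p.2.unpair.1)) (fun y IH => IH.bind fun i =>
        G₂ (p.1, Nat.pair p.2.unpair.1 (Nat.pair y i))) p.2.unpair.2, ?_, ?_, ?_⟩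
    · have hu : Primrec fun p : List Bool × ℕ => p.2.unpair := Primrec.unpair.comp Primrec.snd
      refine Partrec.nat_rec (f := fun p : List Bool × ℕ => p.2.unpair.2)
        (g := fun p => G₁ (p.1, p.2.unpair.1))
        (h := fun p q => G₂ (p.1, Nat.pair p.2.unpair.1 (Nat.pair q.1 q.2)))
        (Primrec.snd.comp hu).to_comp
        (h₁.comp (Primrec.pair Primrec.fst (Primrec.fst.comp hu)).to_comp) ?_
      refine (h₂.comp (f := G₂) (g := fun r : (List Bool × ℕ) × ℕ × ℕ =>
        (r.1.1, Nat.pair r.1.2.unpair.1 (Nat.pair r.2.1 r.2.2))) ?_).to₂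
      exact (Primrec.pair (Primrec.fst.comp Primrec.fst) (Primrec₂.natPair.comp
        (Primrec.fst.comp (hu.comp Primrec.fst)) (Primrec₂.natPair.comp
          (Primrec.fst.comp Primrec.snd) (Primrec.snd.comp Primrec.snd)))).to_comp
    · intro k n
      simp only
      generalize n.unpair.2 = j
      induction j with
      | zero => intro m hm; exact s₁ _ _ _ hm
      | succ j ih =>
        intro m hm
        obtain ⟨i, hi, hm⟩ := Part.mem_bind_iff.1 hm
        exact Part.mem_bind_iff.2 ⟨i, ih _ hi, s₂ _ _ _ hm⟩
    · intro n
      simp only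
      generalize n.unpair.2 = j
      induction j with
      | zero => intro m hm; exact e₁ _ _ hm
      | succ j ih =>
        intro m hm
        obtain ⟨i, hi, hm⟩ := Part.mem_bind_iff.1 hm
        filter_upwards [ih _ hi, e₂ _ _ hm] with k hk₁ hk₂
        exact Part.mem_bind_iff.2 ⟨i, hk₁, hk₂⟩
  | @rfind f _ ih =>
    obtain ⟨G, h, s, e⟩ := ih
    refine ⟨fun p => Nat.rfind fun j => (G (p.1, Nat.pair p.2 j)).map fun m => decide (m = 0),
      ?_, ?_, ?_⟩
    · refine Partrec.rfind (p := fun (p : List Bool × ℕ) j =>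
        (G (p.1, Nat.pair p.2 j)).map fun m => decide (m = 0)) ?_
      have h1 : Primrec fun r : (List Bool × ℕ) × ℕ => (r.1.1, Nat.pair r.1.2 r.2) :=
        Primrec.pair (Primrec.fst.comp Primrec.fst) (Primrec₂.natPair.comp
          (Primrec.snd.comp Primrec.fst) Primrec.snd)
      have h2 : Primrec fun q : ((List Bool × ℕ) × ℕ) × ℕ => decide (q.2 = 0) :=
        (PrimrecRel.comp Primrec.eq Primrec.snd (Primrec.const 0)).decide
      exact (Partrec.map (h.comp h1.to_comp) h2.to_comp.to₂).to₂
    · intro k n m hm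
      refine Nat.mem_rfind.2 ?_
      have hm := Nat.mem_rfind.1 hm
      refine ⟨?_, fun {j} hj => ?_⟩
      · obtain ⟨a, ha, h0⟩ := (Part.mem_map_iff _).1 hm.1
        exact (Part.mem_map_iff _).2 ⟨a, s _ _ _ ha, h0⟩
      · obtain ⟨a, ha, h0⟩ := (Part.mem_map_iff _).1 (hm.2 hj)
        exact (Part.mem_map_iff _).2 ⟨a, s _ _ _ ha, h0⟩
    · intro n m hm
      have hm := Nat.mem_rfind.1 hm
      have h1 : ∀ᶠ k in atTop, true ∈ (G (restr Z k, Nat.pair n m)).map fun m => decide (m = 0) := by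
        obtain ⟨a, ha, h0⟩ := (Part.mem_map_iff _).1 hm.1
        filter_upwards [e _ _ ha] with k hk
        exact (Part.mem_map_iff _).2 ⟨a, hk, h0⟩
      have h2 : ∀ᶠ k in atTop, ∀ j ∈ Finset.range m,
          false ∈ (G (restr Z k, Nat.pair n j)).map fun m => decide (m = 0) := by
        rw [Filter.eventually_all_finset]
        intro j hj
        obtain ⟨a, ha, h0⟩ := (Part.mem_map_iff _).1 (hm.2 (Finset.mem_range.1 hj))
        filter_upwards [e _ _ ha] with k hk
        exact (Part.mem_map_iff _).2 ⟨a, hk, h0⟩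
      filter_upwards [h1, h2] with k hk₁ hk₂
      exact Nat.mem_rfind.2 ⟨hk₁, fun {j} hj => hk₂ j (Finset.mem_range.2 hj)⟩

/-! ### The Turing jump -/

/-- `converges m τ p`: the program `p.unpair.1` halts in `m` steps on the pair of (the code of) `τ`
and `p.unpair.2`. -/
def converges (m : ℕ) (τ : List Bool) (p : ℕ) : Bool :=
  (Nat.Partrec.Code.evaln m (Denumerable.ofNat Nat.Partrec.Code p.unpair.1)
    (Nat.pair (encode τ) p.unpair.2)).isSome

/-- Some suffix of the given list satisfies `converges m · p`. -/
def convergesSuffix (m p : ℕ) (σ : List Bool) : Bool :=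
  List.rec (converges m [] p) (fun b l IH => converges m (b :: l) p || IH) σ

/-- Membership in the jump, as witnessed by a reversed initial segment of the oracle. -/
def inJump (σ : List Bool) (p : ℕ) : Bool := convergesSuffix σ.length p σ

theorem convergesSuffix_iff {m p : ℕ} {σ : List Bool} :
    convergesSuffix m p σ = true ↔ ∃ τ, τ <:+ σ ∧ converges m τ p = true := by
  induction σ with
  | nil => simp [convergesSuffix]
  | cons b l ih =>
    have : convergesSuffix m p (b :: l) = (converges m (b :: l) p || convergesSuffix m p l) := rfl
    rw [this, Bool.or_eq_true, ih]
    constructor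
    · rintro (h | ⟨τ, h, h'⟩)
      · exact ⟨_, List.suffix_refl _, h⟩
      · exact ⟨τ, h.trans (List.suffix_cons _ _), h'⟩
    · rintro ⟨τ, h, h'⟩
      rcases List.suffix_cons_iff.1 h with rfl | h
      · exact Or.inl h'
      · exact Or.inr ⟨τ, h, h'⟩

theorem converges_mono {m m' : ℕ} (h : m ≤ m') {τ : List Bool} {p : ℕ}
    (hc : converges m τ p = true) : converges m' τ p = true := by
  unfold converges at *
  obtain ⟨x, hx⟩ := Option.isSome_iff_exists.1 hc
  exact Option.isSome_iff_exists.2 ⟨x, Nat.Partrec.Code.evaln_mono h hx⟩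

/-- The length of the segment is also the step bound, so a longer segment offers both more time and
more suffixes. -/
theorem inJump_mono {Z : Set ℕ} {s t p : ℕ} (h : s ≤ t) (hs : inJump (restr Z s) p = true) :
    inJump (restr Z t) p = true := by
  unfold inJump at *
  rw [convergesSuffix_iff] at *
  obtain ⟨τ, h1, h2⟩ := hs
  exact ⟨τ, h1.trans (restr_suffix Z h), converges_mono (by simpa using h) h2⟩

theorem primrec_converges : Primrec fun q : ℕ × List Bool × ℕ => converges q.1 q.2.1 q.2.2 := by
  have hu : Primrec fun q : ℕ × List Bool × ℕ => q.2.2.unpair :=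
    Primrec.unpair.comp (Primrec.snd.comp Primrec.snd)
  exact Primrec.option_isSome.comp (Nat.Partrec.Code.primrec_evaln.comp
    (Primrec.pair (Primrec.pair Primrec.fst
      ((Primrec.ofNat Nat.Partrec.Code).comp (Primrec.fst.comp hu)))
      (Primrec₂.natPair.comp (Primrec.encode.comp (Primrec.fst.comp Primrec.snd))
        (Primrec.snd.comp hu))))

theorem primrec_inJump : Primrec₂ inJump := by
  have h : Primrec fun q : List Bool × ℕ => (List.recOn q.1 (converges q.1.length [] q.2)
      fun b l IH => converges q.1.length (b :: l) q.2 || IH : Bool) := by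
    refine Primrec.list_rec (f := fun q : List Bool × ℕ => q.1)
      (g := fun q => converges q.1.length [] q.2)
      (h := fun q r => converges q.1.length (r.1 :: r.2.1) q.2 || r.2.2) Primrec.fst ?_ ?_
    · exact primrec_converges.comp (Primrec.pair (Primrec.list_length.comp Primrec.fst)
        (Primrec.pair (Primrec.const []) Primrec.snd))
    · refine Primrec.or.comp (primrec_converges.comp (Primrec.pair
        (Primrec.list_length.comp (Primrec.fst.comp Primrec.fst)) (Primrec.pair
          (Primrec.list_cons.comp (Primrec.fst.comp Primrec.snd)
            (Primrec.fst.comp (Primrec.snd.comp Primrec.snd)))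
          (Primrec.snd.comp Primrec.fst)))) (Primrec.snd.comp (Primrec.snd.comp Primrec.snd))
  exact h

/-- The Turing jump of `Z`. -/
def jump (Z : Set ℕ) : Set ℕ := {p | ∃ k, inJump (restr Z k) p = true}

theorem mem_jump_iff {Z : Set ℕ} {p : ℕ} : p ∈ jump Z ↔
    ∃ k, ((Denumerable.ofNat Nat.Partrec.Code p.unpair.1).eval
      (Nat.pair (encode (restr Z k)) p.unpair.2)).Dom := by
  constructor
  · rintro ⟨k, hk⟩
    obtain ⟨τ, h1, h2⟩ := convergesSuffix_iff.1 hk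
    obtain ⟨x, hx⟩ := Option.isSome_iff_exists.1 h2
    rw [eq_restr_of_suffix h1] at hx
    exact ⟨τ.length, Part.dom_iff_mem.2 ⟨x, Nat.Partrec.Code.evaln_sound hx⟩⟩
  · rintro ⟨j, hj⟩
    obtain ⟨x, hx⟩ := Part.dom_iff_mem.1 hj
    obtain ⟨m, hm⟩ := Nat.Partrec.Code.evaln_complete.1 hx
    refine ⟨max m j, convergesSuffix_iff.2 ⟨restr Z j, restr_suffix Z (le_max_right _ _), ?_⟩⟩
    refine converges_mono (m := m) (by simp) ?_
    exact Option.isSome_iff_exists.2 ⟨x, hm⟩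

/-- Every semidecidable condition on initial segments is a section of the jump, uniformly in the
oracle. -/
theorem exists_section {P : List Bool × ℕ → Prop} (hP : REPred P) :
    ∃ e, ∀ Z n, Nat.pair e n ∈ jump Z ↔ ∃ k, P (restr Z k, n) := by
  obtain ⟨c, hc⟩ := Nat.Partrec.Code.exists_code.1 hP
  refine ⟨encode c, fun Z n => ?_⟩
  rw [mem_jump_iff]
  simp only [Nat.unpair_pair, Denumerable.ofNat_encode, hc]
  refine exists_congr fun k => ?_
  have : decode (α := List Bool × ℕ) (Nat.pair (encode (restr Z k)) n) = some (restr Z k, n) := by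
    simp [Encodable.decode_prod_val]
  simp [this, Part.assert]

/-! ### Turing reducibility and joins -/

section Reducibility

variable {A B X Y Z : Set ℕ}

theorem Reducible.refl (A : Set ℕ) : Reducible A A := TuringReducible.refl _

theorem Reducible.trans (h : Reducible A B) (h' : Reducible B X) : Reducible A X :=
  TuringReducible.trans h h'

theorem reducible_of_computableIn {P : ℕ → Bool} (hP : ComputableIn {char X} P)
    (h : ∀ n, n ∈ A ↔ P n = true) : Reducible A X := by
  rw [reducible_iff]
  convert hP using 1
  funext n
  rw [Bool.eq_iff_iff, chi_eq_true, h]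

theorem Reducible.preimage (h : Reducible A X) {g : ℕ → ℕ} (hg : Computable g) :
    Reducible {n | g n ∈ A} X :=
  reducible_of_computableIn (computableIn_comp (reducible_iff.1 h) hg.computableIn) (by simp)

theorem Reducible.compl (h : Reducible A X) : Reducible Aᶜ X :=
  reducible_of_computableIn (computableIn_comp Primrec.not.to_comp.computableIn
    (reducible_iff.1 h)) (by simp)

theorem mem_join_even {n : ℕ} : 2 * n ∈ join X Y ↔ n ∈ X := by
  simp only [join, Set.mem_union, Set.mem_image]
  constructor
  · rintro (⟨m, hm, h⟩ | ⟨m, _, h⟩)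
    · obtain rfl : m = n := by omega
      exact hm
    · omega
  · exact fun h => Or.inl ⟨n, h, rfl⟩

theorem mem_join_odd {n : ℕ} : 2 * n + 1 ∈ join X Y ↔ n ∈ Y := by
  simp only [join, Set.mem_union, Set.mem_image]
  constructor
  · rintro (⟨m, _, h⟩ | ⟨m, hm, h⟩)
    · omega
    · obtain rfl : m = n := by omega
      exact hm
  · exact fun h => Or.inr ⟨n, h, rfl⟩

theorem mem_join_iff {n : ℕ} :
    n ∈ join X Y ↔ n % 2 = 0 ∧ n / 2 ∈ X ∨ n % 2 = 1 ∧ n / 2 ∈ Y := by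
  rcases Nat.even_or_odd' n with ⟨m, rfl | rfl⟩
  · rw [mem_join_even]; simp
  · rw [mem_join_odd, show (2 * m + 1) / 2 = m by omega]
    simp [Nat.add_mod]

theorem reducible_join_left : Reducible X (join X Y) := by
  have := (Reducible.refl (join X Y)).preimage
    (Primrec.nat_mul.comp (Primrec.const 2) Primrec.id).to_comp
  simpa [mem_join_even] using this

theorem reducible_join_right : Reducible Y (join X Y) := by
  have := (Reducible.refl (join X Y)).preimage
    (Primrec.succ.comp (Primrec.nat_mul.comp (Primrec.const 2) Primrec.id)).to_comp
  simpa [mem_join_odd] using this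

theorem primrec_mod_two : Primrec fun n : ℕ => decide (n % 2 = 0) :=
  (PrimrecRel.comp Primrec.eq (Primrec.nat_mod.comp Primrec.id (Primrec.const 2))
    (Primrec.const 0)).decide

theorem primrec_div_two : Primrec fun n : ℕ => n / 2 :=
  Primrec.nat_div.comp Primrec.id (Primrec.const 2)

theorem Reducible.join (hX : Reducible X Z) (hY : Reducible Y Z) : Reducible (join X Y) Z := by
  have hP : Primrec fun q : ℕ × Bool × Bool => cond (decide (q.1 % 2 = 0)) q.2.1 q.2.2 :=
    Primrec.cond (primrec_mod_two.comp Primrec.fst) (Primrec.fst.comp Primrec.snd)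
      (Primrec.snd.comp Primrec.snd)
  refine reducible_of_computableIn (computableIn_comp
    (g := fun n : ℕ => (n, chi X (n / 2), chi Y (n / 2))) hP.to_comp.computableIn
    (computableIn_pair ComputableIn.id (computableIn_pair
      (computableIn_comp (reducible_iff.1 hX) primrec_div_two.to_comp.computableIn)
      (computableIn_comp (reducible_iff.1 hY) primrec_div_two.to_comp.computableIn)))) fun n => ?_
  rw [mem_join_iff]
  rcases Nat.mod_two_eq_zero_or_one n with h | h <;> simp [h]

end Reducibility

/-! ### The relativized hierarchy and Post's theorem -/

section Hierarchy

theorem computableIn_comp₂ {α β γ δ : Type*} [Primcodable α] [Primcodable β] [Primcodable γ]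
    [Primcodable δ] {O : Set (ℕ →. ℕ)} {F : β → γ → δ} (hF : Computable₂ F) {f : α → β} {g : α → γ}
    (hf : ComputableIn O f) (hg : ComputableIn O g) : ComputableIn O fun a => F (f a) (g a) :=
  computableIn_comp (f := fun q : β × γ => F q.1 q.2) (g := fun a => (f a, g a))
    (Computable.computableIn hF) (computableIn_pair hf hg)

theorem computableIn_restr_comp {α : Type*} [Primcodable α] {A X : Set ℕ} (h : Reducible A X)
    {f : α → ℕ} (hf : ComputableIn {char X} f) :
    ComputableIn {char X} fun a => restr A (f a) :=
  computableIn_comp (f := restr A) (g := f) (computableIn_restr h) hf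

variable {A B X Y Z : Set ℕ} {n : ℕ}

theorem IsSigma.mono (h : Reducible X Y) (hA : IsSigma X n A) : IsSigma Y n A := by
  induction n generalizing A with
  | zero => exact Reducible.trans hA h
  | succ n ih =>
    obtain ⟨R, hR, rfl⟩ := hA
    exact ⟨R, ih hR, rfl⟩

theorem IsSigma.preimage (hA : IsSigma X n A) {g : ℕ → ℕ} (hg : Computable g) :
    IsSigma X n {m | g m ∈ A} := by
  induction n generalizing A g with
  | zero => exact Reducible.preimage hA hg
  | succ n ih =>
    obtain ⟨R, hR, rfl⟩ := hA
    have hg' : Computable fun p : ℕ => Nat.pair (g p.unpair.1) p.unpair.2 :=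
      Primrec₂.natPair.to_comp.comp (hg.comp (Computable.fst.comp Computable.unpair))
        (Computable.snd.comp Computable.unpair)
    exact ⟨_, ih hR hg', by simp⟩

theorem IsPi.sigma_succ (hA : IsPi X n A) : IsSigma X (n + 1) A :=
  ⟨_, IsSigma.preimage hA (Computable.fst.comp Computable.unpair), by simp⟩

theorem IsSigma.succ (hA : IsSigma X n A) : IsSigma X (n + 1) A := by
  induction n generalizing A with
  | zero => exact IsPi.sigma_succ (Reducible.compl hA)
  | succ n ih =>
    obtain ⟨R, hR, rfl⟩ := hA
    exact ⟨R, ih hR, rfl⟩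

theorem IsSigma.exists (hA : IsSigma X (n + 1) A) :
    IsSigma X (n + 1) {x | ∃ y, Nat.pair x y ∈ A} := by
  obtain ⟨R, hR, rfl⟩ := hA
  have hg : Primrec fun p : ℕ => Nat.pair (Nat.pair p.unpair.1 p.unpair.2.unpair.1)
      p.unpair.2.unpair.2 := by
    have h1 := Primrec.fst.comp Primrec.unpair
    have h2 := Primrec.unpair.comp (Primrec.snd.comp Primrec.unpair)
    exact Primrec₂.natPair.comp (Primrec₂.natPair.comp h1 (Primrec.fst.comp h2))
      (Primrec.snd.comp h2)
  refine ⟨_, hR.preimage hg.to_comp, ?_⟩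
  ext x
  simp only [Set.mem_ofPred_eq, Nat.unpair_pair]
  constructor
  · rintro ⟨y, z, h⟩
    exact ⟨Nat.pair y z, by simpa using h⟩
  · rintro ⟨w, h⟩
    exact ⟨_, _, h⟩

theorem IsSigma.join (hA : IsSigma X n A) (hB : IsSigma X n B) : IsSigma X n (join A B) := by
  induction n generalizing A B with
  | zero => exact Reducible.join hA hB
  | succ n ih =>
    obtain ⟨R, hR, rfl⟩ := hA
    obtain ⟨S, hS, rfl⟩ := hB
    have hg : Primrec fun p : ℕ => 2 * Nat.pair (p.unpair.1 / 2) p.unpair.2 + p.unpair.1 % 2 := by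
      have h1 := Primrec.fst.comp Primrec.unpair
      exact Primrec.nat_add.comp (Primrec.nat_mul.comp (Primrec.const 2)
        (Primrec₂.natPair.comp (primrec_div_two.comp h1) (Primrec.snd.comp Primrec.unpair)))
        (Primrec.nat_mod.comp h1 (Primrec.const 2))
    refine ⟨_, (ih hR hS).preimage hg.to_comp, ?_⟩
    ext x
    rw [mem_join_iff]
    rcases Nat.mod_two_eq_zero_or_one x with h | h
    · simp [h, mem_join_even]
    · simp [h, mem_join_odd]

theorem isSigma_one_of_computableIn {P : ℕ × ℕ → Bool} (hP : ComputableIn {char X} P)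
    (h : ∀ m, m ∈ A ↔ ∃ k, P (m, k) = true) : IsSigma X 1 A := by
  refine ⟨{p | (! P p.unpair) = true}, ?_, ?_⟩
  · exact reducible_of_computableIn (computableIn_comp Primrec.not.to_comp.computableIn
      (computableIn_comp hP ComputableIn.unpair)) (by simp)
  · ext m; simp [h]

theorem isSigma_one_of_computableIn₂ {P : ℕ × ℕ × ℕ → Bool} (hP : ComputableIn {char X} P)
    (h : ∀ m, m ∈ A ↔ ∃ k l, P (m, k, l) = true) : IsSigma X 1 A := by
  refine isSigma_one_of_computableIn (P := fun q => P (q.1, q.2.unpair)) ?_ fun m => ?_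
  · exact computableIn_comp hP (Primrec.pair Primrec.fst
      (Primrec.unpair.comp Primrec.snd)).to_comp.computableIn
  · rw [h]
    constructor
    · rintro ⟨k, l, h⟩
      exact ⟨Nat.pair k l, by simpa using h⟩
    · rintro ⟨w, h⟩
      exact ⟨_, _, h⟩

/-- By the use principle, `y ∉ R` is confirmed by a computable functional giving 0 on some initial
segment of `Z`. Searching for `y` and a halting time makes this a c.e. condition on segments, to
which `exists_section` applies. -/
theorem exists_section_of_isSigma_one (hA : IsSigma Z 1 A) :
    ∃ e, ∀ m, m ∈ A ↔ Nat.pair e m ∈ jump Z := by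
  obtain ⟨R, hR, rfl⟩ := hA
  obtain ⟨G, hG, sound, complete⟩ :=
    exists_functional (RecursiveIn.iff_nat.1 (show TuringReducible (char R) (char Z) from hR))
  obtain ⟨c, hc⟩ := Nat.Partrec.Code.exists_code.1 hG
  have hp : Primrec fun q : (List Bool × ℕ) × ℕ => decide
      (Nat.Partrec.Code.evaln q.2.unpair.1 c (encode (q.1.1, Nat.pair q.1.2 q.2.unpair.2)) =
        some 0) := by
    have hu : Primrec fun q : (List Bool × ℕ) × ℕ => q.2.unpair :=
      Primrec.unpair.comp Primrec.snd
    refine PrimrecPred.decide (PrimrecRel.comp Primrec.eq (Nat.Partrec.Code.primrec_evaln.comp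
      (Primrec.pair (Primrec.pair (Primrec.fst.comp hu) (Primrec.const c)) ?_))
      (Primrec.const (some 0)))
    exact Primrec.encode.comp (Primrec.pair (Primrec.fst.comp Primrec.fst)
      (Primrec₂.natPair.comp (Primrec.snd.comp Primrec.fst) (Primrec.snd.comp hu)))
  have hre : REPred fun q : List Bool × ℕ => ∃ w : ℕ, decide
      (Nat.Partrec.Code.evaln w.unpair.1 c (encode (q.1, Nat.pair q.2 w.unpair.2)) =
        some 0) = true := by
    refine (Partrec.dom_re (Partrec.rfind (p := fun (q : List Bool × ℕ) w => Part.some (decide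
      (Nat.Partrec.Code.evaln w.unpair.1 c (encode (q.1, Nat.pair q.2 w.unpair.2)) =
        some 0))) hp.to_comp.partrec.to₂)).of_eq fun q => ?_
    refine Nat.rfind_dom'.trans ?_
    simp
  obtain ⟨e, he⟩ := exists_section hre
  refine ⟨e, fun m => ?_⟩
  rw [he]
  have key : ∀ k y, 0 ∈ G (restr Z k, y) ↔
      ∃ s, Nat.Partrec.Code.evaln s c (encode (restr Z k, y)) = some 0 := by
    intro k y
    have : 0 ∈ G (restr Z k, y) ↔ 0 ∈ c.eval (encode (restr Z k, y)) := by simp [hc]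
    rw [this, Nat.Partrec.Code.evaln_complete]
    rfl
  have hR0 : ∀ y, y ∉ R ↔ 0 ∈ char R y := by
    intro y
    by_cases hy : y ∈ R
    · have : chi R y = true := by simpa
      simp [char_eq, this, hy]
    · have : chi R y = false := by simpa
      simp [char_eq, this, hy]
  constructor
  · rintro ⟨y, hy⟩
    obtain ⟨k, hk⟩ := (complete _ _ ((hR0 _).1 hy)).exists
    obtain ⟨s, hs⟩ := (key _ _).1 hk
    exact ⟨k, Nat.pair s y, by simpa using hs⟩
  · rintro ⟨k, w, hw⟩
    exact ⟨w.unpair.2, (hR0 _).2 (sound _ _ _ ((key _ _).2 ⟨_, of_decide_eq_true hw⟩))⟩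

theorem isSigma_one_jump (Z : Set ℕ) : IsSigma Z 1 (jump Z) :=
  isSigma_one_of_computableIn (P := fun q => inJump (restr Z q.2) q.1)
    (computableIn_comp₂ primrec_inJump.to_comp
      (computableIn_restr_comp (Reducible.refl Z) ComputableIn.snd) ComputableIn.fst)
    fun _ => Iff.rfl

theorem primrec_natPair_const (e : ℕ) : Primrec fun m => Nat.pair e m :=
  Primrec₂.natPair.comp (Primrec.const e) Primrec.id

theorem IsSigma.reducible_jump (hA : IsSigma Z 1 A) : Reducible A (jump Z) := by
  obtain ⟨e, he⟩ := exists_section_of_isSigma_one hA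
  have := (Reducible.refl (jump Z)).preimage (primrec_natPair_const e).to_comp
  simpa only [← he, Set.ofPred_mem_eq] using this

theorem reducible_jump (Z : Set ℕ) : Reducible Z (jump Z) :=
  IsSigma.reducible_jump (IsSigma.succ (n := 0) (Reducible.refl Z))

theorem IsSigma.jump_of_succ (hA : IsSigma Z (n + 1) A) : IsSigma (jump Z) n A := by
  induction n generalizing A with
  | zero => exact hA.reducible_jump
  | succ n ih =>
    obtain ⟨R, hR, rfl⟩ := hA
    exact ⟨R, ih hR, rfl⟩

/-- The approximation to the initial segment of the jump of length `k`. -/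
def jumpApprox (σ : List Bool) : ℕ → List Bool
  | 0 => []
  | k + 1 => inJump σ k :: jumpApprox σ k

theorem primrec_jumpApprox : Primrec₂ jumpApprox := by
  have h : Primrec fun q : List Bool × ℕ =>
      (q.2.rec [] fun k IH => inJump q.1 k :: IH : List Bool) :=
    Primrec.nat_rec' (f := fun q : List Bool × ℕ => q.2) (g := fun _ => [])
      (h := fun q r => inJump q.1 r.1 :: r.2) Primrec.snd (Primrec.const [])
      (Primrec.list_cons.comp (primrec_inJump.comp (Primrec.fst.comp Primrec.fst)
        (Primrec.fst.comp Primrec.snd)) (Primrec.snd.comp Primrec.snd))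
  refine h.of_eq fun q => ?_
  induction q.2 with
  | zero => rfl
  | succ k ih => simp [jumpApprox, ih]

theorem jumpApprox_eq (σ : List Bool) (k : ℕ) :
    jumpApprox σ k = restr {p | inJump σ p = true} k := by
  induction k with
  | zero => rfl
  | succ k ih =>
    have : inJump σ k = chi {p | inJump σ p = true} k := by rw [Bool.eq_iff_iff]; simp
    simp [jumpApprox, restr, ih, this]

/-- Each of the finitely many bits changes at most once, from false to true. -/
theorem eventually_jumpApprox (Z : Set ℕ) (k : ℕ) :
    ∀ᶠ s in atTop, jumpApprox (restr Z s) k = restr (jump Z) k := by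
  have : ∀ᶠ s in atTop, ∀ p ∈ Finset.range k,
      (inJump (restr Z s) p = true ↔ p ∈ jump Z) := by
    rw [Filter.eventually_all_finset]
    intro p _
    by_cases hp : p ∈ jump Z
    · obtain ⟨s, hs⟩ := hp
      filter_upwards [eventually_ge_atTop s] with t ht
      exact ⟨fun h => ⟨t, h⟩, fun _ => inJump_mono ht hs⟩
    · exact Eventually.of_forall fun t => ⟨fun h => ⟨t, h⟩, fun h => absurd h hp⟩
  filter_upwards [this] with s hs
  rw [jumpApprox_eq]
  exact restr_congr fun p hp => hs p (Finset.mem_range.2 hp)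

/-- Membership is confirmed by a length `k` and a stage `s` such that the approximation to the jump
below `k` never changes after `s` and puts `m` into the section. This is an `∃∀` condition over `Z`.
-/
theorem IsSigma.two_of_jump (hA : IsSigma (jump Z) 1 A) : IsSigma Z 2 A := by
  obtain ⟨e, he⟩ := exists_section_of_isSigma_one hA
  -- The negated condition: `IsSigma` projects the complement of `R`, so `R` collects the pairs `(k,
  -- s)` that fail at some later stage.
  let M : (ℕ × ℕ × ℕ) × List Bool × List Bool → Bool := fun q =>
    ! (decide (jumpApprox q.2.2 q.1.2.1 = jumpApprox q.2.1 q.1.2.1) &&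
      inJump (jumpApprox q.2.1 q.1.2.1) (Nat.pair e q.1.1))
  have hM : Primrec M := by
    have hk : Primrec fun q : (ℕ × ℕ × ℕ) × List Bool × List Bool => q.1.2.1 :=
      Primrec.fst.comp (Primrec.snd.comp Primrec.fst)
    have h1 : Primrec fun q : (ℕ × ℕ × ℕ) × List Bool × List Bool => jumpApprox q.2.1 q.1.2.1 :=
      primrec_jumpApprox.comp (Primrec.fst.comp Primrec.snd) hk
    have h2 : Primrec fun q : (ℕ × ℕ × ℕ) × List Bool × List Bool => jumpApprox q.2.2 q.1.2.1 :=
      primrec_jumpApprox.comp (Primrec.snd.comp Primrec.snd) hk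
    exact Primrec.not.comp (Primrec.and.comp (PrimrecRel.comp Primrec.eq h2 h1).decide
      (primrec_inJump.comp h1 ((primrec_natPair_const e).comp (Primrec.fst.comp Primrec.fst))))
  let ix : ℕ → ℕ × ℕ × ℕ := fun q => (q.unpair.1, q.unpair.2.unpair)
  have hix : Primrec ix := Primrec.pair (Primrec.fst.comp Primrec.unpair)
    (Primrec.unpair.comp (Primrec.snd.comp Primrec.unpair))
  have hr := computableIn_restr (Reducible.refl Z)
  have hc : ComputableIn {char Z} fun q : ℕ × ℕ =>
      M (ix q.1, restr Z (ix q.1).2.2, restr Z ((ix q.1).2.2 + q.2)) := by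
    have h3 : Primrec fun q : ℕ × ℕ => ix q.1 := hix.comp Primrec.fst
    have h4 : Primrec fun q : ℕ × ℕ => (ix q.1).2.2 := Primrec.snd.comp (Primrec.snd.comp h3)
    exact computableIn_comp hM.to_comp.computableIn (computableIn_pair h3.to_comp.computableIn
      (computableIn_pair (computableIn_comp hr h4.to_comp.computableIn)
        (computableIn_comp hr (Primrec.nat_add.comp h4 Primrec.snd).to_comp.computableIn)))
  refine ⟨{q | ∃ t, M (ix q, restr Z (ix q).2.2, restr Z ((ix q).2.2 + t)) = true},
    isSigma_one_of_computableIn hc fun _ => Iff.rfl, ?_⟩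
  ext m
  rw [he]
  simp only [M, ix, Set.mem_ofPred_eq, Nat.unpair_pair, not_exists, Bool.not_eq_true,
    Bool.not_eq_false', Bool.and_eq_true, decide_eq_true_eq]
  constructor
  · rintro ⟨k, hk⟩
    obtain ⟨s, hs⟩ := eventually_atTop.1 (eventually_jumpApprox Z k)
    refine ⟨Nat.pair k s, fun t => ?_⟩
    simp only [Nat.unpair_pair]
    rw [hs _ (Nat.le_add_right s t), hs s le_rfl]
    exact ⟨rfl, hk⟩
  · rintro ⟨y, hy⟩
    obtain ⟨s, hs⟩ := eventually_atTop.1 (eventually_jumpApprox Z y.unpair.1)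
    refine ⟨y.unpair.1, ?_⟩
    -- The stage `y.unpair.2 + s` is past both the guessed stage and the true modulus.
    rw [← hs _ (Nat.le_add_left s y.unpair.2), (hy s).1]
    exact (hy s).2

theorem IsSigma.succ_of_jump (hA : IsSigma (jump Z) (n + 1) A) : IsSigma Z (n + 2) A := by
  induction n generalizing A with
  | zero => exact hA.two_of_jump
  | succ n ih =>
    obtain ⟨R, hR, rfl⟩ := hA
    exact ⟨R, ih hR, rfl⟩

/-- The jump is the diagonal example at the first level; higher levels come from applying lower ones
to the jump as oracle. -/
theorem exists_isSigma_not_isPi (n : ℕ) (Z : Set ℕ) :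
    ∃ K, IsSigma Z (n + 1) K ∧ ¬ IsPi Z (n + 1) K := by
  induction n generalizing Z with
  | zero =>
    refine ⟨jump Z, isSigma_one_jump Z, fun h => ?_⟩
    obtain ⟨e, he⟩ := exists_section_of_isSigma_one (IsSigma.preimage h
      (Primrec₂.natPair.comp Primrec.id Primrec.id).to_comp)
    have := he e
    simp at this
  | succ n ih =>
    obtain ⟨K, hK, hK'⟩ := ih (jump Z)
    exact ⟨K, hK.succ_of_jump, fun h => hK' (IsSigma.jump_of_succ h)⟩

/-- Wait until `m` is enumerated into the set or into its complement, then see which happened. -/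
theorem reducible_of_isDelta_one (h : IsDelta X 1 A) : Reducible A X := by
  obtain ⟨e, he⟩ := exists_section_of_isSigma_one h.1
  obtain ⟨e', he'⟩ := exists_section_of_isSigma_one h.2
  have hI : ∀ e, Computable₂ fun (σ : List Bool) m => inJump σ (Nat.pair e m) := fun e =>
    (primrec_inJump.comp Primrec.fst ((primrec_natPair_const e).comp Primrec.snd)).to_comp.to₂
  have hex : ∀ m, ∃ k, (inJump (restr X k) (Nat.pair e m) ||
      inJump (restr X k) (Nat.pair e' m)) = true := by
    intro m
    by_cases hm : m ∈ A
    · obtain ⟨k, hk⟩ := (he m).1 hm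
      exact ⟨k, by simp [hk]⟩
    · obtain ⟨k, hk⟩ := (he' m).1 hm
      exact ⟨k, by simp [hk]⟩
  have hf := computableIn_find (O := {char X}) (p := fun m k =>
    inJump (restr X k) (Nat.pair e m) || inJump (restr X k) (Nat.pair e' m))
    (computableIn_comp₂ (F := fun (σ : List Bool) m =>
      inJump σ (Nat.pair e m) || inJump σ (Nat.pair e' m))
      ((Primrec.or.to_comp.comp (hI e) (hI e')).to₂)
      (computableIn_restr_comp (Reducible.refl X) ComputableIn.snd) ComputableIn.fst) hex
  refine reducible_of_computableIn (computableIn_comp₂ (hI e)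
    (computableIn_restr_comp (Reducible.refl X) hf) ComputableIn.id) fun m => ?_
  have hs := Nat.find_spec (hex m)
  constructor
  · intro hm
    rw [Bool.or_eq_true] at hs
    rcases hs with hs | hs
    · exact hs
    · exact absurd hm ((he' m).2 ⟨_, hs⟩)
  · exact fun h => (he m).2 ⟨_, h⟩

end Hierarchy

theorem isSigma_two_of_computableIn {A X : Set ℕ} {P : ℕ × ℕ × ℕ → Bool}
    (hP : ComputableIn {char X} P) (h : ∀ m, m ∈ A ↔ ∃ s, ∀ t, P (m, s, t) = true) :
    IsSigma X 2 A := by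
  have hc : ComputableIn {char X} fun q : ℕ × ℕ =>
      ! P (q.1.unpair.1, q.1.unpair.2, q.2) := by
    have hu : Primrec fun q : ℕ × ℕ => (q.1.unpair.1, q.1.unpair.2, q.2) :=
      Primrec.pair (Primrec.fst.comp (Primrec.unpair.comp Primrec.fst))
        (Primrec.pair (Primrec.snd.comp (Primrec.unpair.comp Primrec.fst)) Primrec.snd)
    exact computableIn_comp Primrec.not.to_comp.computableIn
      (computableIn_comp hP hu.to_comp.computableIn)
  refine ⟨{q | ∃ t, (! P (q.unpair.1, q.unpair.2, t)) = true},
    isSigma_one_of_computableIn hc fun _ => Iff.rfl, ?_⟩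
  ext m
  simp [h]

/-! ### A finite injury construction -/

/-- The result of letting the lowest entry of the stack that requires attention act: it is marked,
and everything above it is discarded. The entry `(m, b)` at height `h` requires attention if it is
unmarked and `m` has been enumerated into the c.e. set with index `h.unpair.1`. -/
def act (σ : List Bool) : List (ℕ × Bool) → Option (List (ℕ × Bool))
  | [] => none
  | x :: l => (act σ l).casesOn
      (if (! x.2 && inJump σ (Nat.pair l.length.unpair.1 x.1)) = true
        then some ((x.1, true) :: l) else none) some

/-- One stage of the construction: if no entry requires attention, a new one is pushed. -/
def step (σ : List Bool) (l : List (ℕ × Bool)) : List (ℕ × Bool) :=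
  (act σ l).getD ((σ.length, false) :: l)

/-- The stack after `σ.length` stages. -/
def stack : List Bool → List (ℕ × Bool)
  | [] => []
  | _ :: σ => step σ (stack σ)

/-- The color of `a`, as determined by a stack. -/
def color (a : ℕ) : List (ℕ × Bool) → ℕ
  | [] => 0
  | x :: l => if x.1 ≤ a then (if x.2 = true then l.length.unpair.2 else 0) else color a l

/-- Whether `m` is removed from the set belonging to the color `c`. -/
def removed (c m : ℕ) : List (ℕ × Bool) → Bool
  | [] => false
  | x :: l => (x.2 && (decide (x.1 = m) && decide (l.length.unpair.2 = c))) || removed c m l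

theorem primrec_act : Primrec₂ act := by
  have h : Primrec fun q : List Bool × List (ℕ × Bool) => (List.recOn q.2 none
      fun x l IH => Option.casesOn IH (if (! x.2 && inJump q.1 (Nat.pair l.length.unpair.1 x.1)) =
        true then some ((x.1, true) :: l) else none) some : Option (List (ℕ × Bool))) := by
    refine Primrec.list_rec (f := fun q : List Bool × List (ℕ × Bool) => q.2) (g := fun _ => none)
      (h := fun q r => Option.casesOn r.2.2
        (if (! r.1.2 && inJump q.1 (Nat.pair r.2.1.length.unpair.1 r.1.1)) = true
          then some ((r.1.1, true) :: r.2.1) else none) some) Primrec.snd (Primrec.const none) ?_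
    have hx : Primrec fun p : (List Bool × List (ℕ × Bool)) × (ℕ × Bool) × List (ℕ × Bool) ×
        Option (List (ℕ × Bool)) => p.2.1 := Primrec.fst.comp Primrec.snd
    have hl : Primrec fun p : (List Bool × List (ℕ × Bool)) × (ℕ × Bool) × List (ℕ × Bool) ×
        Option (List (ℕ × Bool)) => p.2.2.1 :=
      Primrec.fst.comp (Primrec.snd.comp Primrec.snd)
    have hσ : Primrec fun p : (List Bool × List (ℕ × Bool)) × (ℕ × Bool) × List (ℕ × Bool) ×
        Option (List (ℕ × Bool)) => p.1.1 := Primrec.fst.comp Primrec.fst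
    refine Primrec.option_casesOn (Primrec.snd.comp (Primrec.snd.comp Primrec.snd))
      (Primrec.ite (PrimrecRel.comp Primrec.eq (Primrec.and.comp
        (Primrec.not.comp (Primrec.snd.comp hx)) (primrec_inJump.comp hσ
          (Primrec₂.natPair.comp (Primrec.fst.comp (Primrec.unpair.comp
            (Primrec.list_length.comp hl))) (Primrec.fst.comp hx)))) (Primrec.const true))
        (Primrec.option_some.comp (Primrec.list_cons.comp
          (Primrec.pair (Primrec.fst.comp hx) (Primrec.const true)) hl)) (Primrec.const none))
      (Primrec.option_some.comp Primrec.snd).to₂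
  refine h.of_eq fun q => ?_
  induction q.2 with
  | nil => rfl
  | cons x l ih => simp only [act, ← ih]

theorem primrec_stack : Primrec stack := by
  have h : Primrec fun q : List Bool => (List.recOn q []
      fun _ σ IH => step σ IH : List (ℕ × Bool)) := by
    refine Primrec.list_rec (f := fun q : List Bool => q) (g := fun _ => [])
      (h := fun _ r => step r.2.1 r.2.2) Primrec.id (Primrec.const []) ?_
    have hσ : Primrec fun p : List Bool × Bool × List Bool × List (ℕ × Bool) => p.2.2.1 :=
      Primrec.fst.comp (Primrec.snd.comp Primrec.snd)
    have hl : Primrec fun p : List Bool × Bool × List Bool × List (ℕ × Bool) => p.2.2.2 :=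
      Primrec.snd.comp (Primrec.snd.comp Primrec.snd)
    exact Primrec.option_getD.comp (primrec_act.comp hσ hl) (Primrec.list_cons.comp
      (Primrec.pair (Primrec.list_length.comp hσ) (Primrec.const false)) hl)
  refine h.of_eq fun q => ?_
  induction q with
  | nil => rfl
  | cons x l ih => simp only [stack, ← ih]

theorem primrec_color : Primrec₂ color := by
  have h : Primrec fun q : ℕ × List (ℕ × Bool) => (List.recOn q.2 0 fun x l IH =>
      if x.1 ≤ q.1 then (if x.2 = true then l.length.unpair.2 else 0) else IH : ℕ) := by
    refine Primrec.list_rec (f := fun q : ℕ × List (ℕ × Bool) => q.2) (g := fun _ => 0)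
      (h := fun q r => if r.1.1 ≤ q.1 then (if r.1.2 = true then r.2.1.length.unpair.2 else 0)
        else r.2.2) Primrec.snd (Primrec.const 0) ?_
    have hx : Primrec fun p : (ℕ × List (ℕ × Bool)) × (ℕ × Bool) × List (ℕ × Bool) × ℕ => p.2.1 :=
      Primrec.fst.comp Primrec.snd
    have hr : Primrec fun p : (ℕ × List (ℕ × Bool)) × (ℕ × Bool) × List (ℕ × Bool) × ℕ => p.2.2 :=
      Primrec.snd.comp Primrec.snd
    exact Primrec.ite (PrimrecRel.comp Primrec.nat_le (Primrec.fst.comp hx)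
      (Primrec.fst.comp Primrec.fst)) (Primrec.ite (PrimrecRel.comp Primrec.eq
        (Primrec.snd.comp hx) (Primrec.const true)) (Primrec.snd.comp (Primrec.unpair.comp
          (Primrec.list_length.comp (Primrec.fst.comp hr)))) (Primrec.const 0))
      (Primrec.snd.comp hr)
  refine h.of_eq fun q => ?_
  induction q.2 with
  | nil => rfl
  | cons x l ih => simp only [color, ← ih]

theorem primrec_removed (c : ℕ) : Primrec₂ (removed c) := by
  have h : Primrec fun q : ℕ × List (ℕ × Bool) => (List.recOn q.2 false fun x l IH =>
      (x.2 && (decide (x.1 = q.1) && decide (l.length.unpair.2 = c))) || IH : Bool) := by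
    refine Primrec.list_rec (f := fun q : ℕ × List (ℕ × Bool) => q.2) (g := fun _ => false)
      (h := fun q r => (r.1.2 && (decide (r.1.1 = q.1) && decide (r.2.1.length.unpair.2 = c))) ||
        r.2.2) Primrec.snd (Primrec.const false) ?_
    have hx : Primrec fun p : (ℕ × List (ℕ × Bool)) × (ℕ × Bool) × List (ℕ × Bool) × Bool =>
        p.2.1 := Primrec.fst.comp Primrec.snd
    have hr : Primrec fun p : (ℕ × List (ℕ × Bool)) × (ℕ × Bool) × List (ℕ × Bool) × Bool =>
        p.2.2 := Primrec.snd.comp Primrec.snd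
    exact Primrec.or.comp (Primrec.and.comp (Primrec.snd.comp hx) (Primrec.and.comp
      (PrimrecRel.comp Primrec.eq (Primrec.fst.comp hx) (Primrec.fst.comp Primrec.fst)).decide
      (PrimrecRel.comp Primrec.eq (Primrec.snd.comp (Primrec.unpair.comp
          (Primrec.list_length.comp (Primrec.fst.comp hr)))) (Primrec.const c)).decide))
      (Primrec.snd.comp hr)
  refine h.of_eq fun q => ?_
  induction q.2 with
  | nil => rfl
  | cons x l ih => simp only [removed, ← ih]

/-! ### Verification of the finite injury construction -/

section Stack

variable {σ : List Bool} {l l' q : List (ℕ × Bool)} {a c m s t w : ℕ} {b : Bool} {Z : Set ℕ}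

theorem act_cons_some {x : ℕ × Bool} (h : act σ l = some l') : act σ (x :: l) = some l' := by
  simp [act, h]

theorem act_cons_none {x : ℕ × Bool} (h : act σ l = none) : act σ (x :: l) =
    if (! x.2 && inJump σ (Nat.pair l.length.unpair.1 x.1)) = true
      then some ((x.1, true) :: l) else none := by
  simp [act, h]

/-- Lower entries have priority: `act` consults an entry only if nothing beneath it acts. -/
theorem act_of_suffix (h : l <:+ q) (hl : act σ l = some l') : act σ q = some l' := by
  obtain ⟨p, rfl⟩ := h
  induction p with
  | nil => exact hl
  | cons x p ih => exact act_cons_some ih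

theorem act_none_of_suffix (h : l <:+ q) (hq : act σ q = none) : act σ l = none := by
  cases hl : act σ l with
  | none => rfl
  | some l' => rw [act_of_suffix h hl] at hq; simp at hq

theorem act_spec (h : act σ l = some l') : ∃ m l₀, l' = (m, true) :: l₀ ∧ (m, false) :: l₀ <:+ l ∧
    inJump σ (Nat.pair l₀.length.unpair.1 m) = true := by
  induction l with
  | nil => simp [act] at h
  | cons x l ih =>
    cases hl : act σ l with
    | some l'' =>
      rw [act_cons_some hl] at h
      obtain ⟨m, l₀, h1, h2, h3⟩ := ih (hl.trans h)
      exact ⟨m, l₀, h1, h2.trans (List.suffix_cons _ _), h3⟩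
    | none =>
      rw [act_cons_none hl] at h
      split_ifs at h with hx
      rw [Bool.and_eq_true, Bool.not_eq_true'] at hx
      refine ⟨x.1, l, (Option.some.inj h).symm, ?_, hx.2⟩
      rw [← hx.1]

theorem not_inJump_of_act_none (h : act σ ((m, false) :: l) = none) :
    inJump σ (Nat.pair l.length.unpair.1 m) = false := by
  rw [act_cons_none (act_none_of_suffix (List.suffix_cons _ _) h)] at h
  simpa using h

/-- An entry which does not require attention is not affected, unless by a lower one. -/
theorem suffix_act (hl : act σ l = none) (h : l <:+ q) (hq : act σ q = some l') : l <:+ l' := by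
  obtain ⟨m, l₀, rfl, h1, h2⟩ := act_spec hq
  have h3 : ¬ (m, false) :: l₀ <:+ l := fun h3 => by
    have := not_inJump_of_act_none (act_none_of_suffix h3 hl)
    simp [this] at h2
  rcases List.suffix_or_suffix_of_suffix h h1 with h | h
  · rcases List.suffix_cons_iff.1 h with rfl | h
    · exact absurd (List.suffix_refl _) h3
    · exact h.trans (List.suffix_cons _ _)
  · exact absurd h h3

theorem stack_succ (Z : Set ℕ) (s : ℕ) : stack (restr Z (s + 1)) =
    (act (restr Z s) (stack (restr Z s))).getD ((s, false) :: stack (restr Z s)) := by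
  simp [restr, stack, step]

theorem suffix_stack_succ (hl : act (restr Z s) l = none) (h : l <:+ stack (restr Z s)) :
    l <:+ stack (restr Z (s + 1)) := by
  rw [stack_succ]
  cases hq : act (restr Z s) (stack (restr Z s)) with
  | none => exact h.trans (List.suffix_cons _ _)
  | some l' => exact suffix_act hl h hq

/-- The entry with number `w` is pushed at stage `w`, and marking keeps its number. An action
beneath it would have discarded it, so what lies below has stayed in place since stage `w`. -/
theorem stack_invariant (h : (w, b) :: l <:+ stack (restr Z s)) :
    w < s ∧ ∀ t, w ≤ t → t ≤ s → l <:+ stack (restr Z t) := by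
  induction s generalizing w b l with
  | zero => simp [restr, stack] at h
  | succ s ih =>
    have key : ∀ {w b l}, (w, b) :: l <:+ stack (restr Z s) → l <:+ stack (restr Z (s + 1)) →
        w < s + 1 ∧ ∀ t, w ≤ t → t ≤ s + 1 → l <:+ stack (restr Z t) := by
      intro w b l h1 h2
      refine ⟨(ih h1).1.trans (Nat.lt_succ_self s), fun t h3 h4 => ?_⟩
      rcases Nat.le_succ_iff.1 h4 with h4 | rfl
      · exact (ih h1).2 t h3 h4
      · exact h2
    have hs := h
    rw [stack_succ] at h
    cases hq : act (restr Z s) (stack (restr Z s)) with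
    | none =>
      rw [hq, Option.getD_none] at h
      rcases List.suffix_cons_iff.1 h with h | h
      · obtain ⟨⟨rfl, rfl⟩, rfl⟩ : (w = s ∧ b = false) ∧ l = stack (restr Z s) := by simpa using h
        refine ⟨Nat.lt_succ_self _, fun t h3 h4 => ?_⟩
        rcases Nat.le_succ_iff.1 h4 with h4 | rfl
        · rw [le_antisymm h4 h3]
        · exact (List.suffix_cons _ _).trans hs
      · exact key h ((List.suffix_cons _ _).trans hs)
    | some l' =>
      rw [hq, Option.getD_some] at h
      obtain ⟨m, l₀, rfl, h1, -⟩ := act_spec hq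
      rcases List.suffix_cons_iff.1 h with h | h
      · obtain ⟨⟨rfl, rfl⟩, rfl⟩ : (w = m ∧ b = true) ∧ l = l₀ := by simpa using h
        exact key h1 ((List.suffix_cons _ _).trans hs)
      · exact key ((h.trans (List.suffix_cons _ _)).trans h1) ((List.suffix_cons _ _).trans hs)

theorem exists_suffix_of_mem {x : ℕ × Bool} (h : x ∈ l) : ∃ l', x :: l' <:+ l := by
  obtain ⟨p, l', rfl⟩ := List.append_of_mem h
  exact ⟨l', List.suffix_append _ _⟩

theorem stack_lt (h : (w, b) :: l <:+ stack (restr Z s)) {x : ℕ × Bool} (hx : x ∈ l) :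
    x.1 < w := by
  obtain ⟨l', hl'⟩ := exists_suffix_of_mem hx
  obtain ⟨h1, h2⟩ := stack_invariant h
  exact (stack_invariant (hl'.trans (h2 w le_rfl h1.le))).1

theorem stack_length_le (Z : Set ℕ) (s : ℕ) : (stack (restr Z s)).length ≤ s := by
  induction s with
  | zero => simp [restr, stack]
  | succ s ih =>
    rw [stack_succ]
    cases hq : act (restr Z s) (stack (restr Z s)) with
    | none => simpa using ih
    | some l' =>
      obtain ⟨m, l₀, rfl, h1, -⟩ := act_spec hq
      have := h1.length_le
      simp only [List.length_cons, Option.getD_some] at *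
      omega

theorem length_le_of_stack (h : (w, b) :: l <:+ stack (restr Z s)) : l.length ≤ w := by
  obtain ⟨h1, h2⟩ := stack_invariant h
  exact (h2 w le_rfl h1.le).length_le.trans (stack_length_le Z w)

theorem inJump_of_stack (h : (m, true) :: l <:+ stack (restr Z s)) :
    inJump (restr Z s) (Nat.pair l.length.unpair.1 m) = true := by
  induction s generalizing m l with
  | zero => simp [restr, stack] at h
  | succ s ih =>
    refine inJump_mono (Nat.le_succ s) ?_
    rw [stack_succ] at h
    cases hq : act (restr Z s) (stack (restr Z s)) with
    | none =>
      rw [hq, Option.getD_none] at h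
      rcases List.suffix_cons_iff.1 h with h | h
      · simp at h
      · exact ih h
    | some l' =>
      rw [hq, Option.getD_some] at h
      obtain ⟨m', l₀, rfl, h1, h2⟩ := act_spec hq
      rcases List.suffix_cons_iff.1 h with h | h
      · obtain ⟨rfl, rfl⟩ : m = m' ∧ l = l₀ := by simpa using h
        exact h2
      · exact ih ((h.trans (List.suffix_cons _ _)).trans h1)

/-- From stage `s` on, `l` is the bottom part of the stack. -/
def Permanent (Z : Set ℕ) (l : List (ℕ × Bool)) (s : ℕ) : Prop :=
  ∀ t, s ≤ t → l <:+ stack (restr Z t)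

theorem Permanent.act_eq_none (h : Permanent Z l s) (ht : s ≤ t) : act (restr Z t) l = none := by
  cases hl : act (restr Z t) l with
  | none => rfl
  | some l' =>
    have h1 := h (t + 1) (ht.trans (Nat.le_succ t))
    rw [stack_succ, act_of_suffix (h t ht) hl, Option.getD_some] at h1
    obtain ⟨m, l₀, rfl, h2, -⟩ := act_spec hl
    -- An action would make the marked and the unmarked version of the same entry coincide.
    have h3 := (h2.trans h1).eq_of_length (by simp)
    simp at h3

theorem permanent_of_act (h : l <:+ stack (restr Z s)) (ha : ∀ t, s ≤ t → act (restr Z t) l = none) :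
    Permanent Z l s := by
  intro t ht
  induction t, ht using Nat.le_induction with
  | base => exact h
  | succ t ht ih => exact suffix_stack_succ (ha t ht) ih

/-- This is the finite injury argument. Above a permanent part, the next entry can be discarded no
more; it acts at most once, and once marked it never requires attention again. -/
theorem exists_permanent (Z : Set ℕ) (j : ℕ) : ∃ l s, l.length = j ∧ Permanent Z l s := by
  induction j with
  | zero => exact ⟨[], 0, rfl, fun t _ => List.nil_suffix⟩
  | succ j ih =>
    obtain ⟨l, s₀, rfl, hl⟩ := ih
    have h1 : ∃ s x, s₀ ≤ s ∧ x :: l <:+ stack (restr Z s) := by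
      have h2 := hl (s₀ + 1) (Nat.le_succ s₀)
      by_cases he : stack (restr Z s₀) = l
      · refine ⟨s₀ + 1, (s₀, false), Nat.le_succ s₀, ?_⟩
        rw [stack_succ, he, hl.act_eq_none le_rfl]
        exact List.suffix_refl _
      · obtain ⟨p, hp⟩ := hl s₀ le_rfl
        rcases List.eq_nil_or_concat p with rfl | ⟨p', x, rfl⟩
        · exact absurd hp.symm he
        · exact ⟨s₀, x, le_rfl, p', by simpa using hp⟩
    obtain ⟨s₁, ⟨m, b⟩, hs₁, hx⟩ := h1
    by_cases hall : ∀ t, s₁ ≤ t → act (restr Z t) ((m, b) :: l) = none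
    · exact ⟨_, s₁, rfl, permanent_of_act hx hall⟩
    · have hex : ∃ t, s₁ ≤ t ∧ act (restr Z t) ((m, b) :: l) ≠ none := by
        simpa using hall
      classical
      obtain ⟨ht, hne⟩ := Nat.find_spec hex
      set t := Nat.find hex with htdef
      have hmin : ∀ r, s₁ ≤ r → r < t → act (restr Z r) ((m, b) :: l) = none := by
        intro r h2 h3
        by_contra h4
        exact Nat.find_min hex h3 ⟨h2, h4⟩
      have hpres : ∀ r, s₁ ≤ r → r ≤ t → (m, b) :: l <:+ stack (restr Z r) := by
        intro r hr
        induction r, hr using Nat.le_induction with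
        | base => exact fun _ => hx
        | succ r hr ih => exact fun h2 => suffix_stack_succ (hmin r hr h2) (ih (Nat.le_of_succ_le h2))
      obtain ⟨l', hl'⟩ := Option.ne_none_iff_exists'.1 hne
      have h3 := hl'
      rw [act_cons_none (hl.act_eq_none (hs₁.trans ht))] at h3
      split_ifs at h3 with hc
      obtain rfl := Option.some.inj h3
      refine ⟨(m, true) :: l, t + 1, rfl, permanent_of_act ?_ fun r hr => ?_⟩
      · rw [stack_succ, act_of_suffix (hpres t ht le_rfl) hl']
        exact List.suffix_refl _
      · rw [act_cons_none (hl.act_eq_none ((hs₁.trans ht).trans (Nat.le_of_succ_le hr)))]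
        simp

theorem exists_permanent_gt (Z : Set ℕ) (a : ℕ) :
    ∃ w b l s, a < w ∧ Permanent Z ((w, b) :: l) s := by
  -- In a stack of length `a + 2` the top entry has height `a + 1`, and its number is at least its
  -- height.
  obtain ⟨l, s, hl, hp⟩ := exists_permanent Z (a + 2)
  match l, hl with
  | (w, b) :: l, hl =>
    have := length_le_of_stack (hp s le_rfl)
    simp only [List.length_cons] at hl
    exact ⟨w, b, l, s, by omega, hp⟩

theorem removed_iff : removed c m q = true ↔
    ∃ l, (m, true) :: l <:+ q ∧ l.length.unpair.2 = c := by
  induction q with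
  | nil => simp [removed]
  | cons x q ih =>
    rw [removed, Bool.or_eq_true, ih]
    simp only [Bool.and_eq_true, decide_eq_true_eq]
    constructor
    · rintro (⟨h1, rfl, h3⟩ | ⟨l, h1, h2⟩)
      · exact ⟨q, by rw [← h1], h3⟩
      · exact ⟨l, h1.trans (List.suffix_cons _ _), h2⟩
    · rintro ⟨l, h1, h2⟩
      rcases List.suffix_cons_iff.1 h1 with h | h
      · obtain ⟨rfl, rfl⟩ := List.cons.inj h
        exact Or.inl ⟨rfl, rfl, h2⟩
      · exact Or.inr ⟨l, h, h2⟩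

theorem removed_mono (h : l <:+ q) (hl : removed c m l = true) : removed c m q = true := by
  obtain ⟨l', h1, h2⟩ := removed_iff.1 hl
  exact removed_iff.2 ⟨l', h1.trans h, h2⟩

/-- Numbers increase up the stack, so above a permanent entry exceeding `m` the number `m` cannot
occur. The limit of colors exists for the same reason. -/
theorem eventually_removed (Z : Set ℕ) (c m : ℕ) :
    ∃ v, ∀ᶠ s in atTop, removed c m (stack (restr Z s)) = v := by
  obtain ⟨w, b, l, s, hw, hp⟩ := exists_permanent_gt Z m
  refine ⟨removed c m ((w, b) :: l), ?_⟩
  filter_upwards [eventually_ge_atTop s] with t ht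
  rw [Bool.eq_iff_iff]
  refine ⟨fun h => ?_, removed_mono (hp t ht)⟩
  obtain ⟨l', h1, h2⟩ := removed_iff.1 h
  rcases List.suffix_or_suffix_of_suffix h1 (hp t ht) with h | h
  · exact removed_iff.2 ⟨l', h, h2⟩
  · rcases List.suffix_cons_iff.1 h with h | h
    · rw [h]; exact removed_iff.2 ⟨l', List.suffix_refl _, h2⟩
    · have := stack_lt h1 (h.mem List.mem_cons_self)
      simp only at this
      omega

theorem color_append {p : List (ℕ × Bool)} (h : ∀ x ∈ p, a < x.1) :
    color a (p ++ l) = color a l := by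
  induction p with
  | nil => rfl
  | cons x p ih =>
    have hx := h x List.mem_cons_self
    rw [List.cons_append, color, if_neg (by omega)]
    exact ih fun y hy => h y (List.mem_cons_of_mem _ hy)

theorem eventually_color (Z : Set ℕ) (a : ℕ) :
    ∃ v, ∀ᶠ s in atTop, color a (stack (restr Z s)) = v := by
  obtain ⟨w, b, l, s, hw, hp⟩ := exists_permanent_gt Z a
  refine ⟨color a ((w, b) :: l), ?_⟩
  filter_upwards [eventually_ge_atTop s] with t ht
  obtain ⟨p, hpt⟩ := hp t ht
  rw [← hpt]
  refine color_append fun x hx => ?_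
  obtain ⟨p₁, p₂, rfl⟩ := List.append_of_mem hx
  have h1 : (x.1, x.2) :: (p₂ ++ (w, b) :: l) <:+ stack (restr Z t) := by
    rw [← hpt]; exact ⟨p₁, by simp⟩
  have := stack_lt h1 (x := (w, b)) (by simp)
  simp only at this
  omega

/-- The color of `a` is read off the topmost entry with number at most `a`. If that were the marked
entry `m`, the color would be the one attached to it; so the entry read lies strictly above. -/
theorem exists_of_color_ne (h : (m, true) :: l <:+ q) (hm : m ≤ a)
    (hc : color a q ≠ l.length.unpair.2) :
    ∃ w b l', (w, b) :: l' <:+ q ∧ w ≤ a ∧ (m, true) :: l <:+ l' := by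
  induction q with
  | nil => simp at h
  | cons x q ih =>
    rcases List.suffix_cons_iff.1 h with h | h
    · obtain ⟨rfl, rfl⟩ := List.cons.inj h
      simp [color, hm] at hc
    · by_cases hx : x.1 ≤ a
      · exact ⟨x.1, x.2, q, List.suffix_refl _, hx, h⟩
      · rw [color, if_neg hx] at hc
        obtain ⟨w, b, l', h1, h2, h3⟩ := ih h hc
        exact ⟨w, b, l', h1.trans (List.suffix_cons _ _), h2, h3⟩

/-- If the color of `a` at a later stage `s` is not `c`, then whatever is removed from the set
belonging to `c` at stage `s` was already removed at stage `a`. -/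
theorem removed_of_color_ne (hm : m ≤ a) (ha : a ≤ s) (hc : color a (stack (restr Z s)) ≠ c)
    (h : removed c m (stack (restr Z s)) = true) : removed c m (stack (restr Z a)) = true := by
  obtain ⟨l, h1, rfl⟩ := removed_iff.1 h
  obtain ⟨w, b, l', h2, h3, h4⟩ := exists_of_color_ne h1 hm hc
  -- The intervening entry `w` dates from stage `w ≤ a`, and the marked `m` below it is therefore on
  -- the stack at stage `a`.
  exact removed_iff.2 ⟨l, h4.trans ((stack_invariant h2).2 a h3 ha), rfl⟩

/-- The set belonging to the color `c`. -/
def kept (Z : Set ℕ) (c : ℕ) : Set ℕ :=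
  {m | ∀ᶠ s in atTop, removed c m (stack (restr Z s)) = false}

theorem notMem_kept : m ∉ kept Z c ↔ ∀ᶠ s in atTop, removed c m (stack (restr Z s)) = true := by
  obtain ⟨v, hv⟩ := eventually_removed Z c m
  constructor
  · intro h
    cases v with
    | false => exact absurd hv h
    | true => exact hv
  · intro h h'
    obtain ⟨s, h1, h2⟩ := (h.and h').exists
    simp [h1] at h2

theorem computable_removed (c : ℕ) :
    Computable₂ fun (m : ℕ) (σ : List Bool) => removed c m (stack σ) :=
  ((primrec_removed c).comp Primrec.fst (primrec_stack.comp Primrec.snd)).to_comp.to₂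

theorem isDelta_kept (Z : Set ℕ) (c : ℕ) : IsDelta Z 2 (kept Z c) := by
  have h : ComputableIn {char Z} fun q : ℕ × ℕ × ℕ =>
      removed c q.1 (stack (restr Z (q.2.1 + q.2.2))) :=
    computableIn_comp₂ (computable_removed c) ComputableIn.fst
      (computableIn_restr_comp (Reducible.refl Z) (Primrec.nat_add.comp
        (Primrec.fst.comp Primrec.snd) (Primrec.snd.comp Primrec.snd)).to_comp.computableIn)
  have key : ∀ p : ℕ → Prop, (∀ᶠ s in atTop, p s) ↔ ∃ s, ∀ t, p (s + t) := by
    intro p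
    rw [eventually_atTop]
    refine exists_congr fun s => ⟨fun h t => h _ (Nat.le_add_right s t), fun h t ht => ?_⟩
    obtain ⟨r, rfl⟩ := Nat.exists_eq_add_of_le ht
    exact h r
  constructor
  · refine isSigma_two_of_computableIn
      (computableIn_comp Primrec.not.to_comp.computableIn h) fun m => ?_
    simp only [Bool.not_eq_true']
    exact key _
  · refine isSigma_two_of_computableIn h fun m => ?_
    rw [Set.mem_compl_iff, notMem_kept]
    exact key _

/-- Look at the permanent entry `m` at height `Nat.pair e c`. If marked, `m` was enumerated with
index `e` but removed; if unmarked, `m` is kept but never enumerated. -/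
theorem not_isSigma_kept (Z : Set ℕ) (c : ℕ) : ¬ IsSigma Z 1 (kept Z c) := by
  intro h
  obtain ⟨e, he⟩ := exists_section_of_isSigma_one h
  obtain ⟨l, s, hl, hp⟩ := exists_permanent Z (Nat.pair e c + 1)
  match l, hl with
  | (m, b) :: l, hl =>
    have hj : l.length = Nat.pair e c := by simpa using hl
    cases b with
    | true =>
      have h1 := inJump_of_stack (hp s le_rfl)
      rw [hj, Nat.unpair_pair] at h1
      refine notMem_kept.2 ?_ ((he m).2 ⟨s, h1⟩)
      filter_upwards [eventually_ge_atTop s] with t ht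
      exact removed_iff.2 ⟨l, hp t ht, by simp [hj]⟩
    | false =>
      have hm : m ∈ kept Z c := by
        -- Removal needs a marked entry with number `m`, and numbers on the stack are distinct.
        by_contra hm
        obtain ⟨t, ht, hst⟩ := ((notMem_kept.1 hm).and (eventually_ge_atTop s)).exists
        obtain ⟨l', h1, -⟩ := removed_iff.1 ht
        rcases List.suffix_or_suffix_of_suffix h1 (hp t hst) with h | h
        · rcases List.suffix_cons_iff.1 h with h' | h'
          · simp at h'
          · exact lt_irrefl _ (stack_lt (hp t hst) (h'.mem List.mem_cons_self))
        · rcases List.suffix_cons_iff.1 h with h' | h'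
          · simp at h'
          · exact lt_irrefl _ (stack_lt h1 (h'.mem List.mem_cons_self))
      obtain ⟨k, hk⟩ := (he m).1 hm
      have h1 := not_inJump_of_act_none (hp.act_eq_none (le_max_left s k))
      rw [hj, Nat.unpair_pair, inJump_mono (le_max_right s k) hk] at h1
      simp at h1

/-- A number `m` is kept exactly when some `a ≥ m` in `X` has `m` not removed at stage `a`. Large
`a` serve for kept `m`; conversely `removed_of_color_ne` shows that an eventual removal is already
visible at every such `a`. -/
theorem exists_of_color {W X : Set ℕ} (hZ : Reducible Z W) (hX : IsSigma W 1 X)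
    (hinf : X.Infinite)
    (h : ∀ a ∈ X, ∀ᶠ s in atTop, color a (stack (restr Z s)) ≠ c) :
    ∃ B, IsDelta Z 2 B ∧ ¬ IsSigma Z 1 B ∧ IsSigma W 1 B := by
  refine ⟨kept Z c, isDelta_kept Z c, not_isSigma_kept Z c, ?_⟩
  obtain ⟨e, he⟩ := exists_section_of_isSigma_one hX
  have hI : Computable₂ fun (σ : List Bool) m => inJump σ (Nat.pair e m) :=
    (primrec_inJump.comp Primrec.fst ((primrec_natPair_const e).comp Primrec.snd)).to_comp.to₂
  have h1 : ComputableIn {char W} fun q : ℕ × ℕ × ℕ => decide (q.1 ≤ q.2.1) :=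
    (PrimrecRel.comp Primrec.nat_le Primrec.fst
      (Primrec.fst.comp Primrec.snd)).decide.to_comp.computableIn
  have h2 : ComputableIn {char W} fun q : ℕ × ℕ × ℕ =>
      inJump (restr W q.2.2) (Nat.pair e q.2.1) :=
    computableIn_comp₂ hI (computableIn_restr_comp (Reducible.refl W)
      (Primrec.snd.comp Primrec.snd).to_comp.computableIn)
      (Primrec.fst.comp Primrec.snd).to_comp.computableIn
  have h3 : ComputableIn {char W} fun q : ℕ × ℕ × ℕ =>
      ! removed c q.1 (stack (restr Z q.2.1)) :=
    computableIn_comp Primrec.not.to_comp.computableIn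
      (computableIn_comp₂ (computable_removed c) ComputableIn.fst
        (computableIn_restr_comp hZ (Primrec.fst.comp Primrec.snd).to_comp.computableIn))
  refine isSigma_one_of_computableIn₂ (computableIn_comp₂ Primrec.and.to_comp h1
    (computableIn_comp₂ Primrec.and.to_comp h2 h3)) fun m => ?_
  simp only [Bool.and_eq_true, decide_eq_true_eq, Bool.not_eq_true']
  constructor
  · intro hm
    obtain ⟨s, hs⟩ := eventually_atTop.1 hm
    obtain ⟨a, haX, ha⟩ := hinf.exists_gt (max s m)
    obtain ⟨k, hk⟩ := (he a).1 haX
    exact ⟨a, k, by omega, hk, hs a (by omega)⟩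
  · rintro ⟨a, k, hma, hk, hr⟩
    by_contra hm
    obtain ⟨s, ⟨hs1, hs2⟩, hs3⟩ := (((notMem_kept.1 hm).and (h a ((he a).2 ⟨k, hk⟩))).and
      (eventually_ge_atTop a)).exists
    have := removed_of_color_ne hma hs3 hs2 hs1
    simp [this] at hr

end Stack

/-! ### Simplifying colorings and the case of pairs -/

/-- The color `c` is not taken on the decreasing sequences of length `n` in `X`, where the color of
`x :: σ` is `Φ (restr Z x) σ`. -/
def Avoids (n : ℕ) (Z : Set ℕ) (Φ : List Bool → List ℕ → ℕ) (X : Set ℕ) (c : ℕ) : Prop :=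
  ∀ x σ, (x :: σ).Pairwise (· > ·) → (x :: σ).length = n → (∀ y ∈ x :: σ, y ∈ X) →
    Φ (restr Z x) σ ≠ c

/-- `Φ` defines a `Z`-computable stable coloring of sequences of length `n`, and at each level
`0 < i < n`, every infinite thin set simplifies the definition of some set. -/
structure Simplifying (n : ℕ) (Z : Set ℕ) (Φ : List Bool → List ℕ → ℕ) : Prop where
  computable : Computable₂ Φ
  stable : ∀ σ, ∃ v, ∀ᶠ x in atTop, Φ (restr Z x) σ = v
  exists_simpler : ∀ i, 0 < i → i < n → ∀ X : Set ℕ, X.Infinite → ∀ c, Avoids n Z Φ X c →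
    ∃ B, IsDelta Z (i + 1) B ∧ ¬ IsSigma Z i B ∧ IsSigma (join X Z) i B

theorem exists_simplifying_two (Z : Set ℕ) : ∃ Φ, Simplifying 2 Z Φ := by
  refine ⟨fun τ σ => color σ.headI (stack τ), ?_, fun σ => eventually_color Z _, ?_⟩
  · exact (primrec_color.comp (Primrec.list_headI.comp Primrec.snd)
      (primrec_stack.comp Primrec.fst)).to_comp.to₂
  · intro i hi hi' X hX c hc
    obtain rfl : i = 1 := by omega
    refine exists_of_color (c := c) reducible_join_right
      (IsSigma.succ (n := 0) reducible_join_left) hX fun a ha => ?_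
    obtain ⟨v, hv⟩ := eventually_color Z a
    obtain ⟨s, hs⟩ := eventually_atTop.1 hv
    -- An `x ∈ X` past the modulus of `a` shows the limit color of `a`, which is thus not `c`.
    obtain ⟨x, hx, hsx⟩ := hX.exists_gt (max s a)
    have h1 := hc x [a] (by simp; omega) rfl (by simp [hx, ha])
    change color a (stack (restr Z x)) ≠ c at h1
    rw [hs x (by omega)] at h1
    filter_upwards [hv] with t ht
    rwa [ht]

/-! ### Gaps that settle the jump -/

section Settled

variable {X Z : Set ℕ} {a b : ℕ}

/-- Membership in the jump of `Z` of the numbers below `a` is decided by stage `b`. -/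
def Settled (Z : Set ℕ) (a b : ℕ) : Prop := jumpApprox (restr Z b) a = restr (jump Z) a

/-- Approximations to the jump only grow, so correctness at stage `b` means no later change. In this
form, failure to be settled is c.e. in `Z`. -/
theorem settled_iff : Settled Z a b ↔
    ∀ s, b ≤ s → jumpApprox (restr Z s) a = jumpApprox (restr Z b) a := by
  constructor
  · intro h s hs
    unfold Settled at h
    rw [jumpApprox_eq] at h ⊢
    rw [jumpApprox_eq]
    refine restr_congr fun p hp => ⟨fun h1 => ?_, inJump_mono hs⟩
    exact (restr_inj h p hp).2 ⟨s, h1⟩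
  · intro h
    obtain ⟨s, h1, h2⟩ := ((eventually_jumpApprox Z a).and (eventually_ge_atTop b)).exists
    exact (h s h2).symm.trans h1

theorem Settled.mem_jump_iff (h : Settled Z a b) {p : ℕ} (hp : p < a) :
    p ∈ jump Z ↔ inJump (restr Z b) p = true := by
  rw [Settled, jumpApprox_eq] at h
  exact (restr_inj h p hp).symm

theorem Settled.mono {a' : ℕ} (h : Settled Z a b) (ha : a' ≤ a) : Settled Z a' b := by
  rw [Settled, jumpApprox_eq]
  exact restr_congr fun p hp => (h.mem_jump_iff (hp.trans_le ha)).symm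

/-- Take the complement of a `Σ_{i+1}` set that is not `Π_{i+1}` over `Z`. An oracle computing the
jump saves one quantifier, so the set is `Σ_i` over `W` and its complement is `Σ_{i+1}`. -/
theorem exists_of_reducible_jump {W : Set ℕ} (h : Reducible (jump Z) W) (i : ℕ) :
    ∃ B, IsDelta Z (i + 2) B ∧ ¬ IsSigma Z (i + 1) B ∧ IsSigma W (i + 1) B := by
  obtain ⟨K, hK, hK'⟩ := exists_isSigma_not_isPi i Z
  refine ⟨Kᶜ, ⟨IsPi.sigma_succ ?_, ?_⟩, hK', IsPi.sigma_succ ?_⟩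
  · rwa [IsPi, compl_compl]
  · rw [IsPi, compl_compl]; exact hK.succ
  · rw [IsPi, compl_compl]; exact hK.jump_of_succ.mono h

theorem computable_jumpApprox_ne : Computable fun q : (ℕ × ℕ × ℕ) × List Bool × List Bool =>
    ! decide (jumpApprox q.2.1 q.1.2.1 = jumpApprox q.2.2 q.1.2.1) := by
  have hk : Primrec fun q : (ℕ × ℕ × ℕ) × List Bool × List Bool => q.1.2.1 :=
    Primrec.fst.comp (Primrec.snd.comp Primrec.fst)
  exact (Primrec.not.comp (PrimrecRel.comp Primrec.eq
    (primrec_jumpApprox.comp (Primrec.fst.comp Primrec.snd) hk)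
    (primrec_jumpApprox.comp (Primrec.snd.comp Primrec.snd) hk)).decide).to_comp

/-- The members of `X` which are preceded by a gap that is too small for the jump. -/
theorem isSigma_one_unsettled (X Z : Set ℕ) (M : ℕ) : IsSigma (join X Z) 1
    {b | b ∈ X ∧ ∃ a ∈ X, M ≤ a ∧ a < b ∧ ¬ Settled Z a b} := by
  have hX : ∀ {f : ℕ × ℕ × ℕ → ℕ}, Primrec f →
      ComputableIn {char (join X Z)} fun q => chi X (f q) := fun hf =>
    computableIn_comp (reducible_iff.1 reducible_join_left) hf.to_comp.computableIn
  have ha : Primrec fun q : ℕ × ℕ × ℕ => q.2.1 := Primrec.fst.comp Primrec.snd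
  have hs : Primrec fun q : ℕ × ℕ × ℕ => q.2.2 := Primrec.snd.comp Primrec.snd
  have h1 : Primrec fun q : ℕ × ℕ × ℕ =>
      decide (M ≤ q.2.1) && (decide (q.2.1 < q.1) && decide (q.1 ≤ q.2.2)) :=
    Primrec.and.comp (PrimrecRel.comp Primrec.nat_le (Primrec.const M) ha).decide
      (Primrec.and.comp (PrimrecRel.comp Primrec.nat_lt ha Primrec.fst).decide
        (PrimrecRel.comp Primrec.nat_le Primrec.fst hs).decide)
  have h2 : ComputableIn {char (join X Z)} fun q : ℕ × ℕ × ℕ =>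
      ! decide (jumpApprox (restr Z q.2.2) q.2.1 = jumpApprox (restr Z q.1) q.2.1) :=
    computableIn_comp (g := fun q : ℕ × ℕ × ℕ => (q, restr Z q.2.2, restr Z q.1))
      computable_jumpApprox_ne.computableIn (computableIn_pair ComputableIn.id (computableIn_pair
        (computableIn_restr_comp reducible_join_right hs.to_comp.computableIn)
        (computableIn_restr_comp reducible_join_right ComputableIn.fst)))
  refine isSigma_one_of_computableIn₂ (computableIn_comp₂ Primrec.and.to_comp (hX Primrec.fst)
    (computableIn_comp₂ Primrec.and.to_comp (hX ha)
      (computableIn_comp₂ Primrec.and.to_comp h1.to_comp.computableIn h2))) fun b => ?_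
  simp only [Set.mem_ofPred_eq, Bool.and_eq_true, chi_eq_true, decide_eq_true_eq,
    Bool.not_eq_true', decide_eq_false_iff_not, settled_iff, not_forall]
  constructor
  · rintro ⟨hb, a, ha, h1, h2, s, hs, h3⟩
    exact ⟨a, s, hb, ha, ⟨h1, h2, hs⟩, h3⟩
  · rintro ⟨a, s, hb, ha, ⟨h1, h2, hs⟩, h3⟩
    exact ⟨hb, a, ha, h1, h2, s, hs, h3⟩

/-- A number `p` is outside the jump exactly when some settled gap `a < b` in `X`, with `N ≤ a` and
`p < a`, has not seen `p` by stage `b`. So the complement of the jump is also c.e. in the join. -/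
theorem reducible_jump_of_settled (hX : X.Infinite) (N : ℕ)
    (h : ∀ a ∈ X, N ≤ a → ∀ b ∈ X, a < b → Settled Z a b) : Reducible (jump Z) (join X Z) := by
  refine reducible_of_isDelta_one ⟨(isSigma_one_jump Z).mono reducible_join_right, ?_⟩
  have hX' : ∀ {f : ℕ × ℕ × ℕ → ℕ}, Primrec f →
      ComputableIn {char (join X Z)} fun q => chi X (f q) := fun hf =>
    computableIn_comp (reducible_iff.1 reducible_join_left) hf.to_comp.computableIn
  have ha : Primrec fun q : ℕ × ℕ × ℕ => q.2.1 := Primrec.fst.comp Primrec.snd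
  have hs : Primrec fun q : ℕ × ℕ × ℕ => q.2.2 := Primrec.snd.comp Primrec.snd
  have h1 : Primrec fun q : ℕ × ℕ × ℕ =>
      decide (N ≤ q.2.1) && (decide (q.2.1 < q.2.2) && decide (q.1 < q.2.1)) :=
    Primrec.and.comp (PrimrecRel.comp Primrec.nat_le (Primrec.const N) ha).decide
      (Primrec.and.comp (PrimrecRel.comp Primrec.nat_lt ha hs).decide
        (PrimrecRel.comp Primrec.nat_lt Primrec.fst ha).decide)
  have h2 : ComputableIn {char (join X Z)} fun q : ℕ × ℕ × ℕ =>
      ! inJump (restr Z q.2.2) q.1 :=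
    computableIn_comp Primrec.not.to_comp.computableIn
      (computableIn_comp₂ primrec_inJump.to_comp
        (computableIn_restr_comp reducible_join_right hs.to_comp.computableIn) ComputableIn.fst)
  refine isSigma_one_of_computableIn₂ (computableIn_comp₂ Primrec.and.to_comp (hX' ha)
    (computableIn_comp₂ Primrec.and.to_comp (hX' hs)
      (computableIn_comp₂ Primrec.and.to_comp h1.to_comp.computableIn h2))) fun p => ?_
  simp only [Set.mem_compl_iff, Bool.and_eq_true, chi_eq_true, decide_eq_true_eq,
    Bool.not_eq_true']
  constructor
  · intro hp
    obtain ⟨a, ha, h1⟩ := hX.exists_gt (max N p)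
    obtain ⟨b, hb, h2⟩ := hX.exists_gt a
    refine ⟨a, b, ha, hb, ⟨by omega, h2, by omega⟩, ?_⟩
    rw [(h a ha (by omega) b hb h2).mem_jump_iff (by omega)] at hp
    simpa using hp
  · rintro ⟨a, b, ha, hb, ⟨h1, h2, h3⟩, h4⟩
    rw [(h a ha h1 b hb h2).mem_jump_iff h3, h4]
    simp

/-- Choose greedily: accept `b ∈ X` when its gap from the last accepted number is settled. The jump
decides this, and any fixed gap start is eventually settled, so the process never stops. -/
theorem exists_settled_subset (hX : X.Infinite) (Z : Set ℕ) : ∃ Y ⊆ X, Y.Infinite ∧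
    Reducible Y (join X (jump Z)) ∧ ∀ a ∈ Y, ∀ b ∈ Y, a < b → Settled Z a b := by
  let W := join X (jump Z)
  let G : ℕ × (Bool × List Bool × List Bool) × ℕ → ℕ := fun q =>
    if (q.2.1.1 && decide (jumpApprox q.2.1.2.1 q.2.2 = q.2.1.2.2.drop (q.1 - q.2.2))) = true
      then q.1 else q.2.2
  let v : ℕ → Bool × List Bool × List Bool := fun b => (chi X b, restr Z b, restr (jump Z) b)
  -- The last number accepted before `b`. The initial value 0 imposes no condition, since nothing
  -- lies below 0.
  let last : ℕ → ℕ := fun b => b.rec 0 fun b IH => G (b, v b, IH)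
  have hXW : Reducible X W := reducible_join_left
  have hjW : Reducible (jump Z) W := reducible_join_right
  have hZW : Reducible Z W := (reducible_jump Z).trans hjW
  have hv : ComputableIn {char W} v := computableIn_pair (reducible_iff.1 hXW)
    (computableIn_pair (computableIn_restr hZW) (computableIn_restr hjW))
  have hG : Primrec G := by
    have h1 : Primrec fun q : ℕ × (Bool × List Bool × List Bool) × ℕ => q.2.1 :=
      Primrec.fst.comp Primrec.snd
    have h2 : Primrec fun q : ℕ × (Bool × List Bool × List Bool) × ℕ => q.2.2 :=
      Primrec.snd.comp Primrec.snd
    exact Primrec.ite (PrimrecRel.comp Primrec.eq (Primrec.and.comp (Primrec.fst.comp h1)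
      (PrimrecRel.comp Primrec.eq (primrec_jumpApprox.comp (Primrec.fst.comp (Primrec.snd.comp h1))
        h2) (Primrec.list_drop.comp (Primrec.nat_sub.comp Primrec.fst h2)
          (Primrec.snd.comp (Primrec.snd.comp h1)))).decide) (Primrec.const true)) Primrec.fst h2
  have hlast : ComputableIn {char W} last :=
    computableIn_natRec hv 0 hG.to_comp (g := last) rfl fun _ => rfl
  have hle : ∀ b, last b ≤ b := by
    intro b
    induction b with
    | zero => exact le_rfl
    | succ b ih =>
      change G (b, v b, last b) ≤ b + 1
      simp only [G]
      split_ifs <;> omega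
  let Y : Set ℕ := {b | b ∈ X ∧ Settled Z (last b) b}
  have hsucc : ∀ b, b ∈ Y → last (b + 1) = b := by
    rintro b ⟨hb, hb'⟩
    change G (b, v b, last b) = b
    simp only [G, v]
    rw [restr_drop _ (hle b), if_pos]
    rw [Bool.and_eq_true, chi_eq_true, decide_eq_true_eq]
    exact ⟨hb, hb'⟩
  have hsucc' : ∀ b, b ∉ Y → last (b + 1) = last b := by
    intro b hb
    change G (b, v b, last b) = last b
    simp only [G, v]
    rw [restr_drop _ (hle b), if_neg]
    intro h
    rw [Bool.and_eq_true, chi_eq_true, decide_eq_true_eq] at h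
    exact hb h
  have hmono : Monotone last := by
    refine monotone_nat_of_le_succ fun b => ?_
    by_cases hb : b ∈ Y
    · rw [hsucc b hb]; exact hle b
    · rw [hsucc' b hb]
  refine ⟨Y, fun b hb => hb.1, ?_, ?_, ?_⟩
  · intro hfin
    obtain ⟨N, hN⟩ := hfin.bddAbove
    have hconst : ∀ b, N + 1 ≤ b → last b = last (N + 1) := by
      intro b hb
      induction b, hb using Nat.le_induction with
      | base => rfl
      | succ b hb ih =>
        rw [hsucc' b fun h => ?_, ih]
        have := hN h
        omega
    obtain ⟨s, hs⟩ := eventually_atTop.1 (eventually_jumpApprox Z (last (N + 1)))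
    obtain ⟨b, hb, hsb⟩ := hX.exists_gt (max s (N + 1))
    have hbY : b ∈ Y := by
      refine ⟨hb, ?_⟩
      rw [hconst b (by omega)]
      exact hs b (by omega)
    have := hN hbY
    omega
  · have h1 : Computable₂ fun (σ : List Bool) (q : ℕ × List Bool) =>
        decide (jumpApprox σ q.1 = q.2) :=
      (PrimrecRel.comp Primrec.eq (primrec_jumpApprox.comp Primrec.fst
        (Primrec.fst.comp Primrec.snd)) (Primrec.snd.comp Primrec.snd)).decide.to_comp.to₂
    refine reducible_of_computableIn (computableIn_comp₂ Primrec.and.to_comp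
      (reducible_iff.1 hXW) (computableIn_comp₂ h1 (computableIn_restr hZW)
        (computableIn_pair hlast (computableIn_restr_comp hjW hlast)))) fun b => ?_
    rw [Bool.and_eq_true, chi_eq_true, decide_eq_true_eq]
    rfl
  · intro a ha b hb hab
    -- Being settled up to the last accepted number suffices for all earlier ones.
    refine hb.2.mono ?_
    rw [← hsucc a ha]
    exact hmono hab

end Settled

/-! ### The induction on the exponent -/

theorem exists_decreasing {X : Set ℕ} (hX : X.Infinite) (k : ℕ) : ∃ (ρ : List ℕ) (M : ℕ),
    ρ.Pairwise (· > ·) ∧ ρ.length = k ∧ (∀ y ∈ ρ, y ∈ X) ∧ ∀ y ∈ ρ, y < M := by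
  induction k with
  | zero => exact ⟨[], 0, List.Pairwise.nil, rfl, by simp, by simp⟩
  | succ k ih =>
    obtain ⟨ρ, M, h1, h2, h3, h4⟩ := ih
    obtain ⟨x, hx, hM⟩ := hX.exists_gt M
    refine ⟨x :: ρ, x + 1, List.pairwise_cons.2 ⟨fun y hy => (h4 y hy).trans hM, h1⟩,
      by simp [h2], ?_, ?_⟩
    · simpa [hx] using h3
    · intro y hy
      rcases List.mem_cons.1 hy with rfl | hy
      · omega
      · have := h4 y hy
        omega

/-- The coloring of sequences of length `n + 1` which, depending on whether the gap between the
last two terms of the given sequence of length `n` seems settled, approximates the coloring `Φ` or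
uses the finite injury construction. -/
def extendColoring (Φ : List Bool → List ℕ → ℕ) (τ : List Bool) (σ : List ℕ) : ℕ :=
  if jumpApprox (τ.drop (τ.length - σ.headI)) σ.tail.headI = jumpApprox τ σ.tail.headI
    then Φ (jumpApprox τ σ.headI) σ.tail else color σ.headI (stack τ)

theorem computable_extendColoring {Φ : List Bool → List ℕ → ℕ} (hΦ : Computable₂ Φ) :
    Computable₂ (extendColoring Φ) := by
  have hb : Primrec fun q : List Bool × List ℕ => q.2.headI :=
    Primrec.list_headI.comp Primrec.snd
  have ht : Primrec fun q : List Bool × List ℕ => q.2.tail := Primrec.list_tail.comp Primrec.snd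
  have ha : Primrec fun q : List Bool × List ℕ => q.2.tail.headI := Primrec.list_headI.comp ht
  have hc : Primrec fun q : List Bool × List ℕ => decide
      (jumpApprox (q.1.drop (q.1.length - q.2.headI)) q.2.tail.headI =
        jumpApprox q.1 q.2.tail.headI) :=
    (PrimrecRel.comp Primrec.eq (primrec_jumpApprox.comp (Primrec.list_drop.comp
      (Primrec.nat_sub.comp (Primrec.list_length.comp Primrec.fst) hb) Primrec.fst) ha)
      (primrec_jumpApprox.comp Primrec.fst ha)).decide
  have h1 : Computable fun q : List Bool × List ℕ => Φ (jumpApprox q.1 q.2.headI) q.2.tail :=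
    hΦ.comp (primrec_jumpApprox.comp Primrec.fst hb).to_comp ht.to_comp
  have h2 : Computable fun q : List Bool × List ℕ => color q.2.headI (stack q.1) :=
    (primrec_color.comp hb (primrec_stack.comp Primrec.fst)).to_comp
  refine (Computable.cond hc.to_comp h1 h2).of_eq fun q => ?_
  rw [extendColoring, Bool.cond_decide]

/-- For `x ≥ σ.headI`, the dropped list is the initial segment of `Z` at stage `σ.headI`, and the
approximations at stage `x` are eventually true. The test in `extendColoring` thus eventually
decides whether the gap is settled. -/
theorem extendColoring_of_settled (Φ : List Bool → List ℕ → ℕ) {Z : Set ℕ} {σ : List ℕ}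
    (h : Settled Z σ.tail.headI σ.headI) :
    ∀ᶠ x in atTop, extendColoring Φ (restr Z x) σ = Φ (restr (jump Z) σ.headI) σ.tail := by
  filter_upwards [eventually_ge_atTop σ.headI, eventually_jumpApprox Z σ.headI,
    eventually_jumpApprox Z σ.tail.headI] with x h1 h2 h3
  rw [extendColoring, restr_length, restr_drop Z h1, h2, h3, if_pos (by exact h)]

theorem extendColoring_of_not_settled (Φ : List Bool → List ℕ → ℕ) {Z : Set ℕ} {σ : List ℕ}
    (h : ¬ Settled Z σ.tail.headI σ.headI) :
    ∀ᶠ x in atTop, extendColoring Φ (restr Z x) σ = color σ.headI (stack (restr Z x)) := by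
  filter_upwards [eventually_ge_atTop σ.headI,
    eventually_jumpApprox Z σ.tail.headI] with x h1 h3
  rw [extendColoring, restr_length, restr_drop Z h1, h3, if_neg (by exact h)]

theorem Simplifying.extend {n : ℕ} (hn : 2 ≤ n) {Z : Set ℕ} {Φ : List Bool → List ℕ → ℕ}
    (h : Simplifying n (jump Z) Φ) : Simplifying (n + 1) Z (extendColoring Φ) := by
  refine ⟨computable_extendColoring h.computable, fun σ => ?_, ?_⟩
  · by_cases hs : Settled Z σ.tail.headI σ.headI
    · exact ⟨_, extendColoring_of_settled Φ hs⟩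
    · obtain ⟨v, hv⟩ := eventually_color Z σ.headI
      exact ⟨v, ((extendColoring_of_not_settled Φ hs).and hv).mono fun x hx => hx.1.trans hx.2⟩
  · intro i hi hi' X hX c hc
    have hpair : ∀ σ : List ℕ, σ.Pairwise (· > ·) → σ.length = n → (∀ y ∈ σ, y ∈ X) →
        ∃ᶠ x in atTop, extendColoring Φ (restr Z x) σ ≠ c := by
      intro σ h1 h2 h3
      rw [frequently_atTop]
      intro s
      -- Exceeding `σ.sum` puts `x` above every term of `σ`.
      obtain ⟨x, hx, hs⟩ := hX.exists_gt (max s σ.sum)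
      refine ⟨x, by omega, hc x σ (List.pairwise_cons.2 ⟨fun y hy => ?_, h1⟩) (by simp [h2]) ?_⟩
      · have := List.le_sum_of_mem hy
        omega
      · simpa [hx] using h3
    obtain rfl | ⟨j, hj, rfl⟩ : i = 1 ∨ ∃ j, 0 < j ∧ i = j + 1 := by
      rcases Nat.eq_or_lt_of_le hi with h | h
      · exact Or.inl h.symm
      · exact Or.inr ⟨i - 1, by omega, by omega⟩
    -- A fixed tail `ρ` below `M` completes every pair `a < b` with `M ≤ a` to a sequence of length
    -- `n`.
    · obtain ⟨ρ, M, h1, h2, h3, h4⟩ := exists_decreasing hX (n - 2)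
      by_cases hY : {b | b ∈ X ∧ ∃ a ∈ X, M ≤ a ∧ a < b ∧ ¬ Settled Z a b}.Infinite
      · refine exists_of_color (c := c) reducible_join_right (isSigma_one_unsettled X Z M) hY ?_
        rintro b ⟨hb, a, ha, hMa, hab, hs⟩
        have hlt : ∀ y ∈ ρ, y < a := fun y hy => (h4 y hy).trans_le hMa
        have h5 := hpair (b :: a :: ρ)
          (List.pairwise_cons.2 ⟨by
            intro y hy
            rcases List.mem_cons.1 hy with rfl | hy
            · exact hab
            · exact (hlt y hy).trans hab, List.pairwise_cons.2 ⟨hlt, h1⟩⟩)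
          (by simp only [List.length_cons]; omega) (by simpa [ha, hb] using h3)
        obtain ⟨v, hv⟩ := eventually_color Z b
        obtain ⟨x, hx1, hx2, hx3⟩ :=
          (h5.and_eventually ((extendColoring_of_not_settled Φ (σ := b :: a :: ρ) hs).and hv)).exists
        rw [hx2, List.headI_cons, hx3] at hx1
        exact hv.mono fun t ht => by rwa [ht]
      -- Only finitely many `b` end an unsettled gap, so beyond `N` the set `X` gives a modulus for
      -- the jump.
      · obtain ⟨N, hN⟩ := (Set.not_infinite.1 hY).bddAbove
        refine exists_of_reducible_jump (reducible_jump_of_settled hX (max M (N + 1)) ?_) 0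
        intro a ha h5 b hb hab
        by_contra hs
        have : b ≤ N := hN ⟨hb, a, ha, (le_max_left _ _).trans h5, hab, hs⟩
        omega
    · obtain ⟨Y, hYX, hY, hYr, hYs⟩ := exists_settled_subset hX Z
      have hav : Avoids n (jump Z) Φ Y c := by
        intro b σ h1 h2 h3
        match σ with
        | [] => simp at h2; omega
        | a :: ρ =>
          have h4 := hpair (b :: a :: ρ) h1 h2 fun y hy => hYX (h3 y hy)
          have hs : Settled Z a b := hYs a (h3 a (by simp)) b (h3 b (by simp))
            ((List.pairwise_cons.1 h1).1 a (by simp))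
          obtain ⟨x, hx1, hx2⟩ :=
            (h4.and_eventually (extendColoring_of_settled Φ (σ := b :: a :: ρ) hs)).exists
          rwa [hx2] at hx1
      obtain ⟨B, hB1, hB2, hB3⟩ := h.exists_simpler j hj (by omega) Y hY c hav
      -- The thinned set was found using the jump of `Z`, so the jump of `X ⊕ Z` absorbs it.
      have hW : Reducible (join Y (jump Z)) (jump (join X Z)) :=
        (hYr.join reducible_join_right).trans
          ((reducible_join_left.trans (reducible_jump _)).join
            ((isSigma_one_jump Z).mono reducible_join_right).reducible_jump)
      obtain ⟨k, rfl⟩ : ∃ k, j = k + 1 := ⟨j - 1, by omega⟩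
      exact ⟨B, ⟨hB1.1.succ_of_jump, IsSigma.succ_of_jump hB1.2⟩,
        fun hB => hB2 hB.jump_of_succ, (hB3.mono hW).succ_of_jump⟩

theorem exists_simplifying {n : ℕ} (hn : 2 ≤ n) (Z : Set ℕ) : ∃ Φ, Simplifying n Z Φ := by
  induction n, hn using Nat.le_induction generalizing Z with
  | base => exact exists_simplifying_two Z
  | succ n hn ih =>
    obtain ⟨Φ, h⟩ := ih (jump Z)
    exact ⟨_, h.extend hn⟩

theorem primrec_restr_empty : Primrec (restr ∅) := by
  refine (Primrec.nat_rec₁ (f := fun _ (l : List Bool) => false :: l) []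
    (Primrec.list_cons.comp (Primrec.const false) Primrec.snd)).of_eq fun k => ?_
  induction k with
  | zero => rfl
  | succ k ih =>
    have : chi ∅ k = false := by simp
    simp only [restr, this, ← ih]

/-! ### From decreasing lists to colorings of `[ω]^n` -/

section Coloring

variable {n : ℕ}

theorem seq_eq_reverse {s : Set.powersetCard ℕ n} {l : List ℕ} (hl : l.Pairwise (· > ·))
    (hs : (s : Finset ℕ) = l.toFinset) : seq s = l.reverse := by
  have h : l.reverse.Pairwise (· < ·) := List.pairwise_reverse.2 hl
  rw [seq, hs, ← List.toFinset_reverse]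
  exact (List.toFinset_sort (r := (· ≤ ·)) (h.imp ne_of_lt)).2 (h.imp le_of_lt)

theorem pairwise_seq (s : Set.powersetCard ℕ n) : (seq s).Pairwise (· < ·) :=
  (Finset.sortedLT_sort _).pairwise

theorem length_seq (s : Set.powersetCard ℕ n) : (seq s).length = n := by
  rw [seq, Finset.length_sort]; exact s.2

/-- The color of an increasing sequence. -/
noncomputable def colorSeq (Φ : List Bool → List ℕ → ℕ) (l : List ℕ) : ℕ :=
  Φ (restr ∅ l.reverse.headI) l.reverse.tail

theorem computable_colorSeq {Φ : List Bool → List ℕ → ℕ} (h : Computable₂ Φ) :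
    Computable (colorSeq Φ) :=
  h.comp (primrec_restr_empty.comp (Primrec.list_headI.comp Primrec.list_reverse)).to_comp
    (Primrec.list_tail.comp Primrec.list_reverse).to_comp

theorem isStable_colorSeq {Φ : List Bool → List ℕ → ℕ} (h : Simplifying n ∅ Φ) :
    Coloring.IsStable (n := n) fun s => colorSeq Φ (seq s) := by
  intro σ hσ
  obtain ⟨v, hv⟩ := h.stable (σ.sort (· ≤ ·)).reverse
  refine ⟨v, ?_⟩
  filter_upwards [hv, eventually_gt_atTop (σ.sup id)] with x hx hσx τ hτ
  have hlt : ∀ y ∈ σ, y < x := fun y hy => (Finset.le_sup (f := id) hy).trans_lt hσx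
  have h1 : (x :: (σ.sort (· ≤ ·)).reverse).Pairwise (· > ·) := by
    refine List.pairwise_cons.2 ⟨fun y hy => hlt y ?_, ?_⟩
    · simpa using hy
    · exact List.pairwise_reverse.2 (Finset.sortedLT_sort σ).pairwise
  have h2 := seq_eq_reverse (s := τ) h1 (by rw [hτ]; ext; simp)
  rw [h2, colorSeq, List.reverse_reverse]
  exact hx

theorem avoids_of_isThin {Φ : List Bool → List ℕ → ℕ} {X : Set ℕ}
    (h : Coloring.IsThin (n := n) (fun s => colorSeq Φ (seq s)) X) : ∃ c, Avoids n ∅ Φ X c := by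
  obtain ⟨c, hc⟩ := (Set.ne_univ_iff_exists_notMem _).1 h
  refine ⟨c, fun x σ h1 h2 h3 he => hc ?_⟩
  have hcard : (x :: σ).toFinset.card = n := by
    rw [List.toFinset_card_of_nodup (h1.imp ne_of_gt), h2]
  refine ⟨⟨(x :: σ).toFinset, hcard⟩, ?_, ?_⟩
  · intro y hy
    exact h3 y (List.mem_toFinset.1 hy)
  · simp only
    rw [seq_eq_reverse h1 rfl, colorSeq, List.reverse_reverse]
    exact he

/-- Whether a sequence is strictly increasing. -/
def increasing : List ℕ → Bool
  | [] => true
  | x :: l => (decide (l = []) || decide (x < l.headI)) && increasing l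

theorem increasing_iff {l : List ℕ} : increasing l = true ↔ l.Pairwise (· < ·) := by
  rw [← List.isChain_iff_pairwise]
  induction l with
  | nil => simp [increasing]
  | cons x l ih =>
    rw [increasing, Bool.and_eq_true, ih]
    cases l with
    | nil => simp
    | cons y l =>
      rw [List.isChain_cons_cons]
      refine and_congr_left fun _ => ?_
      rw [Bool.or_eq_true, decide_eq_true_eq, decide_eq_true_eq]
      simp

theorem primrec_increasing : Primrec increasing := by
  have h : Primrec fun q : List ℕ => (List.recOn q true fun x l IH =>
      (decide (l = []) || decide (x < l.headI)) && IH : Bool) := by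
    refine Primrec.list_rec (f := fun q : List ℕ => q) (g := fun _ => true)
      (h := fun _ r => (decide (r.2.1 = []) || decide (r.1 < r.2.1.headI)) && r.2.2)
      Primrec.id (Primrec.const true) ?_
    have hx : Primrec fun p : List ℕ × ℕ × List ℕ × Bool => p.2.1 :=
      Primrec.fst.comp Primrec.snd
    have hl : Primrec fun p : List ℕ × ℕ × List ℕ × Bool => p.2.2.1 :=
      Primrec.fst.comp (Primrec.snd.comp Primrec.snd)
    exact Primrec.and.comp (Primrec.or.comp
      (PrimrecRel.comp Primrec.eq hl (Primrec.const [])).decide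
      (PrimrecRel.comp Primrec.nat_lt hx (Primrec.list_headI.comp hl)).decide)
      (Primrec.snd.comp (Primrec.snd.comp Primrec.snd))
  refine h.of_eq fun q => ?_
  induction q with
  | nil => rfl
  | cons x l ih => simp only [increasing, ← ih]

/-- Whether a code is that of an increasing sequence of length `n` is decidable. This makes the
coloring an admissible instance over the oracle `∅`. -/
theorem reducible_graph {F : List ℕ → ℕ} (hF : Computable F) :
    Reducible (Coloring.graph (n := n) fun s => F (seq s)) ∅ := by
  let l : ℕ → List ℕ := fun m => Denumerable.ofNat (List ℕ) m.unpair.1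
  have hl : Primrec l := (Primrec.ofNat (List ℕ)).comp (Primrec.fst.comp Primrec.unpair)
  have h1 : Computable fun m => decide ((l m).length = n) && increasing (l m) :=
    (Primrec.and.comp (PrimrecRel.comp Primrec.eq (Primrec.list_length.comp hl)
      (Primrec.const n)).decide (primrec_increasing.comp hl)).to_comp
  have h2 : Computable fun m : ℕ => decide (F (l m) = m.unpair.2) :=
    (PrimrecRel.decide Primrec.eq).to_comp.comp (hF.comp hl.to_comp)
      (Computable.snd.comp Computable.unpair)
  refine reducible_of_computableIn (Primrec.and.to_comp.comp h1 h2).computableIn fun m => ?_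
  rw [Bool.and_eq_true, Bool.and_eq_true, decide_eq_true_eq, decide_eq_true_eq, increasing_iff]
  constructor
  · rintro ⟨s, rfl⟩
    have : l (Nat.pair (encode (seq s)) (F (seq s))) = seq s := by
      simp only [l, Nat.unpair_pair]
      exact Denumerable.ofNat_encode _
    rw [this]
    exact ⟨⟨length_seq s, pairwise_seq s⟩, by simp⟩
  · rintro ⟨⟨h3, h4⟩, h5⟩
    have hcard : (l m).toFinset.card = n := by
      rw [List.toFinset_card_of_nodup (h4.imp ne_of_lt), h3]
    have hs : seq (n := n) ⟨(l m).toFinset, hcard⟩ = l m := by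
      rw [seq_eq_reverse (l := (l m).reverse) (List.pairwise_reverse.2 h4) (by simp),
        List.reverse_reverse]
    refine ⟨⟨(l m).toFinset, hcard⟩, ?_⟩
    simp only
    rw [hs, h5]
    have : encode (l m) = m.unpair.1 := Denumerable.encode_ofNat _
    rw [this, Nat.pair_unpair]

end Coloring

/-! ### From simplified definitions to failure of preservation -/

section Join

variable {A B X : Set ℕ} {n : ℕ}

theorem isSigma_of_join_left (h : IsSigma X n (join A B)) : IsSigma X n A := by
  have := h.preimage (Primrec.nat_mul.comp (Primrec.const 2) Primrec.id).to_comp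
  simpa [mem_join_even] using this

theorem isSigma_of_join_right (h : IsSigma X n (join A B)) : IsSigma X n B := by
  have := h.preimage
    (Primrec.succ.comp (Primrec.nat_mul.comp (Primrec.const 2) Primrec.id)).to_comp
  simpa [mem_join_odd] using this

theorem compl_join : (join A B)ᶜ = join Aᶜ Bᶜ := by
  ext m
  rw [Set.mem_compl_iff, mem_join_iff, mem_join_iff]
  rcases Nat.mod_two_eq_zero_or_one m with h | h <;> simp [h]

/-- The given set may well be `Π_{n+1}`. Joining it with a `Σ_{n+1}` set that is not `Π_{n+1}` rules
this out and keeps the join from being `Σ_{n+1}`. -/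
theorem exists_isProperDeltaSucc (h : IsDelta X (n + 2) A) (hA : ¬ IsSigma X (n + 1) A) :
    ∃ K, IsSigma X (n + 1) K ∧ IsProperDeltaSucc (n + 1) X (join A K) := by
  obtain ⟨K, hK, hK'⟩ := exists_isSigma_not_isPi n X
  refine ⟨K, hK, ⟨h.1.join hK.succ, ?_⟩, fun hj => hA (isSigma_of_join_left hj), fun hj => hK' ?_⟩
  · rw [IsPi, compl_join]
    refine IsSigma.join h.2 (IsPi.sigma_succ ?_)
    rwa [IsPi, compl_compl]
  · rw [IsPi, compl_join] at hj
    exact isSigma_of_join_right hj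

end Join

end Definability

theorem mainTheorem5 (n : ℕ) (hn : 1 < n) :
    (∃ f : Definability.Coloring n, f.IsComputable ∧ f.IsStable ∧
      ∀ i : ℕ, 0 < i → i < n → ∀ X : Set ℕ, X.Infinite → f.IsThin X →
        ∃ B : Set ℕ, Definability.IsDelta ∅ (i + 1) B ∧ ¬ Definability.IsSigma ∅ i B ∧
          Definability.IsSigma X i B) ∧
    ∀ i : ℕ, 0 < i → i < n →
      ¬ Definability.AdmitsPreservation
          (Definability.IsProperDeltaSucc i) (Definability.STS n) ∧
      ¬ Definability.AdmitsPreservation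
          (Definability.IsProperDeltaSucc i) (Definability.TS n) := by
  open Definability in
  obtain ⟨Φ, hΦ⟩ := exists_simplifying hn ∅
  have hF := computable_colorSeq hΦ.computable
  have hst := isStable_colorSeq hΦ
  have key : ∀ i : ℕ, 0 < i → i < n → ∀ X : Set ℕ, X.Infinite →
      Coloring.IsThin (n := n) (fun s => colorSeq Φ (seq s)) X →
      ∃ B : Set ℕ, IsDelta ∅ (i + 1) B ∧ ¬ IsSigma ∅ i B ∧ IsSigma X i B := by
    intro i hi hin X hX hthin
    obtain ⟨c, hc⟩ := avoids_of_isThin hthin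
    obtain ⟨B, h1, h2, h3⟩ := hΦ.exists_simpler i hi hin X hX c hc
    have h0 : Reducible ∅ X :=
      reducible_of_computableIn (ComputableIn.const false) (by simp)
    exact ⟨B, h1, h2, h3.mono ((Reducible.refl X).join h0)⟩
  have hSTS : ∀ i : ℕ, 0 < i → i < n → ¬ AdmitsPreservation (IsProperDeltaSucc i) (STS n) := by
    intro i hi hin h
    obtain ⟨Y, hY, hφ⟩ := h ∅ _ (reducible_graph (n := n) hF)
    obtain ⟨hinf, hthin⟩ := hφ _ rfl hst
    obtain ⟨B, h1, h2, h3⟩ := key i hi hin Y hinf hthin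
    obtain ⟨j, rfl⟩ : ∃ j, i = j + 1 := ⟨i - 1, by omega⟩
    obtain ⟨K, hK, hp⟩ := exists_isProperDeltaSucc h1 h2
    -- Over `Y` both halves of the join are `Σ_i`, so the join is no longer properly `Δ_{i+1}`.
    exact (hY _ hp).2.1 ((h3.mono reducible_join_right).join (hK.mono reducible_join_left))
  refine ⟨⟨fun s => colorSeq Φ (seq s), ⟨_, hF, fun _ => rfl⟩, hst, key⟩, fun i hi hin =>
    ⟨hSTS i hi hin, fun h => hSTS i hi hin fun Z X hXZ => ?_⟩⟩
  -- A solution for all colorings is in particular one for stable colorings.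
  obtain ⟨Y, hY, hφ⟩ := h Z X hXZ
  exact ⟨Y, hY, fun f hf _ => hφ f hf⟩
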